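/- **Setting.** Fix a countably infinite set of values. A schema is a finite set $S$ of relation symbols with arities $\geq 0$; an $S$-database $D$ is a finite set of facts $R(\bar v)$ with $R\in S$; $\mathrm{adom}(D)$ is the set of values occurring in $D$. A pointed database is a pair $D^v$ with $v\in\mathrm{adom}(D)$. A value property is a set of pointed $S$-databases; a class of classifiers expresses it if some classifier of the class accepts exactly its members. A formalism $\mathcal C_2$ is at least as expressive as $\mathcal C_1$ if, over every schema, every property expressible in $\mathcal C_1$ is expressible in $\mathcal C_2$; they have the same expressive power if this holds in both directions, and $\mathcal C_2$ is strictly more expressive if it holds in this direction only. **Networks.** A pattern $F^w$ consists of a finite set $F$ of facts, a finite set $V_F\supseteq \mathrm{adom}(F)$ of values, and a point $w\in V_F$. A homomorphism $F^w\to D^u$ is a map $h:V_F\to\mathrm{adom}(D)$ with $h(w)=u$ that preserves facts; it is an embedding if it is moreover injective and reflects facts. A homomorphism (embedding) query of input dimension $d$ and output dimension $d'>0$ with aggregation $\mathrm{agg}$ consists of a pattern $F^w$ and arbitrary functions $\mu_x:\mathbb R^d\to\mathbb R^{d'}$ for $x\in V_F$; on $D^u$ with $\lambda:\mathrm{adom}(D)\to\mathbb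 R^d$ it returns, computed component-wise, $\mathrm{agg}\{\!\{\prod_{x\in V_F}\mu_x(\lambda(h(x)))\mid h\}\!\}$, with $h$ ranging over the homomorphisms (embeddings) $F^w\to D^u$. A layer consists of finitely many queries and an arbitrary combination function applied to their results, and yields a new map $\mathrm{adom}(D)\to\mathbb R^{d''}$. An $\mathrm{agg}$-DHN ($\mathrm{agg}$-DEN) is a finite sequence of layers of matching dimensions whose queries are homomorphism (embedding) queries with aggregation $\mathrm{agg}$, started from the empty ($0$-dimensional) vector at every value, together with an arbitrary classification function from $\mathbb R^{k}$ to $\{0,1\}$, $k$ the final dimension. It accepts $D^v$ if the final vector of $v$ is classified as $1$. Here $\mathrm{agg}\in\{\mathrm{sum},\max\}$ and $\max\emptyset=0$. **Logics.** Quantifiers range over $\mathrm{adom}(D)$. UQAFO formulas are given by $\varphi(\bar x)::=\varphi_\exists(\bar x)\mid\varphi_\forall(\bar x)\mid\varphi(\bar x)\circ\varphi(\bar x)$, where $\varphi_\exists(\bar x)::=R(\bar x)\mid\neg R(\bar x)\mid x_i=x_j\mid x_i\neq x_j\mid\varphi_\exists(\bar x)\circ\varphi_\exists(\bar x)\mid\exists\bar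 y\,\varphi_\exists(\bar x,\bar y)\mid\varphi_\forall(x_i)$, $\varphi_\forall(\bar x)::=R(\bar x)\mid\neg R(\bar x)\mid x_i=x_j\mid x_i\neq x_j\mid\varphi_\forall(\bar x)\circ\varphi_\forall(\bar x)\mid\forall\bar y\,\varphi_\forall(\bar x,\bar y)\mid\varphi_\exists(x_i)$, and $\circ\in\{\wedge,\vee\}$; UQAFO formulas in one free variable are used as classifiers. EML formulas are given by $\varphi(x)::=\neg\varphi(x)\mid\varphi(x)\vee\varphi(x)\mid\exists\bar y\,\psi(x,\bar y)$, where $\psi$ is a finite conjunction of atoms $R(\bar z)$, negated atoms $\neg R(\bar z)$, inequalities $z_1\neq z_2$ and EML formulas $\varphi(z)$ in one variable. **Theorem.** 1. UQAFO, EML and max-DENs have the same expressive power. 2. sum-DENs are strictly more expressive than UQAFO. In particular, over the schema with a binary symbol $E$ and unary symbols $P,Q,R$, the following property (PQR-order) of $D^v$ is expressible by a sum-DEN but not by a UQAFO formula: $v$ and the vertices reachable from $v$ via $E$ can be listed without repetition as $v=v_0,\dots,v_n$ with $n\bmod 3=2$, such that $E(v_i,v_j)\in D$ iff $i\le j$,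 and $v_i$ satisfies $P$ iff $i\bmod 3=0$, $Q$ iff $i\bmod 3=1$, and $R$ iff $i\bmod 3=2$. 3. sum-DENs and sum-DHNs have the same expressive power. 4. max-DENs are strictly more expressive than max-DHNs. In particular, over the schema with a single binary symbol $E$, local transitivity of $v$ (for all $u_1,u_2$: $E(v,u_1),E(u_1,u_2)\in D$ implies $E(v,u_2)\in D$) is expressible by a max-DEN but not by a max-DHN. -/

import Mathlib

namespace DeepNet

/-! ### Schemas, databases, pointed databases -/

/-- A schema: finitely many relation symbols, each with an arity (possibly `0`). -/
structure Schema where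
  Rel : Type
  finite : Finite Rel
  arity : Rel → ℕ

/-- The fixed countably infinite set of values. -/
abbrev Value : Type := ℕ

/-- A fact `R(v₁, …, vₖ)` over the schema `S`, with `k` the arity of `R`. -/
@[ext] structure Fact (S : Schema) where
  rel : S.Rel
  args : Fin (S.arity rel) → Value

/-- A database is a finite set of facts. -/
abbrev Database (S : Schema) : Type := Finset (Fact S)

/-- The active domain: the values that are used in some fact. -/
def adom {S : Schema} (D : Database S) : Finset Value :=
  D.biUnion fun f => Finset.univ.image f.args

/-- A pointed database `D^v`, with `v` in the active domain of `D`. -/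
structure PointedDatabase (S : Schema) where
  db : Database S
  pt : Value
  pt_mem : pt ∈ adom db

/-- The distinguished value as an element of the active domain. -/
def PointedDatabase.point {S : Schema} (X : PointedDatabase S) : adom X.db :=
  ⟨X.pt, X.pt_mem⟩

/-- A value property is a set of pointed databases. -/
abbrev ValueProperty (S : Schema) : Type := Set (PointedDatabase S)

/-! ### Classes of value classifiers and their expressive power -/

/-- A class of value classifiers over `S`. -/
structure ClassifierClass (S : Schema) where
  Classifier : Type
  accepts : Classifier → PointedDatabase S → Prop

/-- `P` consists of exactly the pointed databases accepted by some classifier of the class. -/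
def ClassifierClass.Expresses {S : Schema} (C : ClassifierClass S) (P : ValueProperty S) : Prop :=
  ∃ c : C.Classifier, ∀ X : PointedDatabase S, X ∈ P ↔ C.accepts c X

/-- A formalism provides a class of value classifiers over every schema. -/
abbrev Formalism : Type 1 := (S : Schema) → ClassifierClass S

/-- `C₂` is at least as expressive as `C₁`. -/
def AtLeastAsExpressive (C₂ C₁ : Formalism) : Prop :=
  ∀ (S : Schema) (P : ValueProperty S), (C₁ S).Expresses P → (C₂ S).Expresses P

/-- `C₁` and `C₂` have the same expressive power. -/
def SameExpressivePower (C₁ C₂ : Formalism) : Prop :=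
  AtLeastAsExpressive C₁ C₂ ∧ AtLeastAsExpressive C₂ C₁

/-- `C₂` is strictly more expressive than `C₁`. -/
def StrictlyMoreExpressive (C₂ C₁ : Formalism) : Prop :=
  AtLeastAsExpressive C₂ C₁ ∧ ¬ AtLeastAsExpressive C₁ C₂

/-! ### Patterns, homomorphisms, embeddings -/

/-- A pattern: a pointed database with an explicit finite set `dom` of values, which contains the
active domain and may also contain values that occur in no fact (such as the pattern that
consists of a single value and no fact). -/
structure Pattern (S : Schema) where
  db : Database S
  dom : Finset Value
  adom_subset : adom db ⊆ dom
  pt : Value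
  pt_mem : pt ∈ dom

/-- Homomorphisms from the pointed pattern `F` to the pointed database `D^u`. -/
def IsHom {S : Schema} (F : Pattern S) (D : Database S) (u : adom D) (h : F.dom → adom D) : Prop :=
  h ⟨F.pt, F.pt_mem⟩ = u ∧
    ∀ (R : S.Rel) (t : Fin (S.arity R) → F.dom),
      (⟨R, fun i => (t i : Value)⟩ : Fact S) ∈ F.db →
        (⟨R, fun i => (h (t i) : Value)⟩ : Fact S) ∈ D

/-- Embeddings: injective homomorphisms that also reflect facts. -/
def IsEmb {S : Schema} (F : Pattern S) (D : Database S) (u : adom D) (h : F.dom → adom D) : Prop :=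
  IsHom F D u h ∧ Function.Injective h ∧
    ∀ (R : S.Rel) (t : Fin (S.arity R) → F.dom),
      (⟨R, fun i => (h (t i) : Value)⟩ : Fact S) ∈ D →
        (⟨R, fun i => (t i : Value)⟩ : Fact S) ∈ F.db

/-- Whether the queries of a network are homomorphism queries or embedding queries. -/
inductive MapKind where
  | hom
  | emb

/-- The mappings that a query of the given kind aggregates over. -/
def MapKind.IsMap (k : MapKind) {S : Schema} (F : Pattern S) (D : Database S) (u : adom D)
    (h : F.dom → adom D) : Prop :=
  match k with
  | .hom => IsHom F D u h
  | .emb => IsEmb F D u h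

/-! ### Aggregation -/

/-- Aggregation functions take finite multisets of reals to reals. -/
abbrev Aggregation : Type := Multiset ℝ → ℝ

/-- Sum aggregation. -/
def sumAgg : Aggregation := fun M => M.sum

/-- Max aggregation, with `max ∅ = 0`. -/
noncomputable def maxAgg : Aggregation := fun M => M.toFinset.max.unbotD 0

/-! ### Deep homomorphism networks and deep embedding networks

Both kinds of networks have the same syntax; they differ in whether queries range over
homomorphisms or over embeddings. In an `agg`-network all queries use the aggregation `agg`. -/

/-- A query with input dimension `d`: a pattern whose values are labelled by transformation
functions. -/
structure Query (S : Schema) (d : ℕ) where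
  pattern : Pattern S
  outDim : ℕ
  outDim_pos : 0 < outDim
  trans : pattern.dom → (Fin d → ℝ) → (Fin outDim → ℝ)

open Classical in
/-- The result of a query on the embedded pointed database `(D^u, lam)`. -/
noncomputable def Query.eval {S : Schema} {d : ℕ} (q : Query S d) (k : MapKind)
    (agg : Aggregation) (D : Database S) (lam : adom D → Fin d → ℝ) (u : adom D) :
    Fin q.outDim → ℝ :=
  fun i => agg
    ((Finset.univ.filter fun h : q.pattern.dom → adom D => k.IsMap q.pattern D u h).val.map
      fun h => ∏ v : q.pattern.dom, q.trans v (lam (h v)) i)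

/-- A layer with input dimension `d` and output dimension `d'`: a finite sequence of queries and
a combination function. -/
structure Layer (S : Schema) (d d' : ℕ) where
  numQueries : ℕ
  query : Fin numQueries → Query S d
  com : ((j : Fin numQueries) → Fin (query j).outDim → ℝ) → (Fin d' → ℝ)

/-- The embedding produced by a layer. -/
noncomputable def Layer.apply {S : Schema} {d d' : ℕ} (L : Layer S d d') (k : MapKind)
    (agg : Aggregation) (D : Database S) (lam : adom D → Fin d → ℝ) : adom D → Fin d' → ℝ :=
  fun u => L.com fun j => (L.query j).eval k agg D lam u

/-- Finite sequences of layers with matching dimensions; the input dimension of the first layer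
is `0` and the index is the output dimension of the last layer. -/
inductive LayerSeq (S : Schema) : ℕ → Type where
  | nil : LayerSeq S 0
  | snoc {d d' : ℕ} (Ls : LayerSeq S d) (L : Layer S d d') : LayerSeq S d'

/-- The embedding computed by a sequence of layers from the empty embedding. -/
noncomputable def LayerSeq.features {S : Schema} (k : MapKind) (agg : Aggregation)
    (D : Database S) : {d : ℕ} → LayerSeq S d → adom D → Fin d → ℝ
  | _, .nil => fun _ => Fin.elim0
  | _, .snoc Ls L => L.apply k agg D (LayerSeq.features k agg D Ls)

/-- A network: a sequence of layers and a classification function. -/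
structure Network (S : Schema) where
  dim : ℕ
  layers : LayerSeq S dim
  cls : (Fin dim → ℝ) → Bool

/-- Acceptance of a pointed database by a network. -/
def Network.Accepts {S : Schema} (N : Network S) (k : MapKind) (agg : Aggregation)
    (X : PointedDatabase S) : Prop :=
  N.cls (N.layers.features k agg X.db X.point) = true

/-- `agg`-DHNs. -/
def DHN (agg : Aggregation) : Formalism := fun S =>
  { Classifier := Network S, accepts := fun N X => N.Accepts .hom agg X }

/-- `agg`-DENs. -/
def DEN (agg : Aggregation) : Formalism := fun S =>
  { Classifier := Network S, accepts := fun N X => N.Accepts .emb agg X }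

/-! ### The unary quantifier alternation fragment UQAFO

Formulas are kept in context: the variables are numbered by `Fin n`, and a quantifier binds a new
variable with number `0`. All variables range over the active domain. -/

/-- The existential and the universal kind of formulas. -/
inductive QKind where
  | ex
  | all

/-- `KindFormula S .ex n` are the formulas generated by `φ_∃` and `KindFormula S .all n` those
generated by `φ_∀`, with free variables among `n` given ones. In `altAll` and `altEx` the formula
of the other kind has at most one free variable, which is instantiated by `x i`. -/
inductive KindFormula (S : Schema) : QKind → ℕ → Type where
  | rel {k : QKind} {n : ℕ} (R : S.Rel) (z : Fin (S.arity R) → Fin n) : KindFormula S k n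
  | notRel {k : QKind} {n : ℕ} (R : S.Rel) (z : Fin (S.arity R) → Fin n) : KindFormula S k n
  | eq {k : QKind} {n : ℕ} (i j : Fin n) : KindFormula S k n
  | ne {k : QKind} {n : ℕ} (i j : Fin n) : KindFormula S k n
  | and {k : QKind} {n : ℕ} (φ ψ : KindFormula S k n) : KindFormula S k n
  | or {k : QKind} {n : ℕ} (φ ψ : KindFormula S k n) : KindFormula S k n
  | ex {n : ℕ} (φ : KindFormula S .ex (n + 1)) : KindFormula S .ex n
  | all {n : ℕ} (φ : KindFormula S .all (n + 1)) : KindFormula S .all n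
  | altAll {n : ℕ} (i : Fin n) (φ : KindFormula S .all 1) : KindFormula S .ex n
  | altEx {n : ℕ} (i : Fin n) (φ : KindFormula S .ex 1) : KindFormula S .all n

/-- Satisfaction in `D` under an assignment of the free variables. -/
def KindFormula.Sat {S : Schema} (D : Database S) :
    {k : QKind} → {n : ℕ} → KindFormula S k n → (Fin n → adom D) → Prop
  | _, _, .rel R z, v => (⟨R, fun i => (v (z i) : Value)⟩ : Fact S) ∈ D
  | _, _, .notRel R z, v => (⟨R, fun i => (v (z i) : Value)⟩ : Fact S) ∉ D
  | _, _, .eq i j, v => v i = v j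
  | _, _, .ne i j, v => v i ≠ v j
  | _, _, .and φ ψ, v => φ.Sat D v ∧ ψ.Sat D v
  | _, _, .or φ ψ, v => φ.Sat D v ∨ ψ.Sat D v
  | _, n, .ex φ, v => ∃ a : adom D, φ.Sat D (Fin.cons a v : Fin (n + 1) → adom D)
  | _, n, .all φ, v => ∀ a : adom D, φ.Sat D (Fin.cons a v : Fin (n + 1) → adom D)
  | _, _, .altAll i φ, v => φ.Sat D fun _ => v i
  | _, _, .altEx i φ, v => φ.Sat D fun _ => v i

/-- UQAFO formulas with free variables among `n` given ones. -/
inductive UQAFOFormula (S : Schema) (n : ℕ) : Type where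
  | ofKind {k : QKind} (φ : KindFormula S k n) : UQAFOFormula S n
  | and (φ ψ : UQAFOFormula S n) : UQAFOFormula S n
  | or (φ ψ : UQAFOFormula S n) : UQAFOFormula S n

/-- Satisfaction of UQAFO formulas. -/
def UQAFOFormula.Sat {S : Schema} (D : Database S) {n : ℕ} :
    UQAFOFormula S n → (Fin n → adom D) → Prop
  | .ofKind φ, v => φ.Sat D v
  | .and φ ψ, v => φ.Sat D v ∧ ψ.Sat D v
  | .or φ ψ, v => φ.Sat D v ∨ ψ.Sat D v

/-- UQAFO formulas in one free variable as value classifiers. -/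
def UQAFO : Formalism := fun S =>
  { Classifier := UQAFOFormula S 1, accepts := fun φ X => φ.Sat X.db fun _ => X.point }

/-! ### Embedding modal logic -/

/-- The atomic conjuncts of EML over `n` variables: relational atoms, negated relational atoms,
and inequalities. -/
inductive EMLLiteral (S : Schema) (n : ℕ) : Type where
  | rel (R : S.Rel) (z : Fin (S.arity R) → Fin n) : EMLLiteral S n
  | notRel (R : S.Rel) (z : Fin (S.arity R) → Fin n) : EMLLiteral S n
  | ne (i j : Fin n) : EMLLiteral S n

/-- Satisfaction of literals. -/
def EMLLiteral.Sat {S : Schema} (D : Database S) {n : ℕ} :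
    EMLLiteral S n → (Fin n → adom D) → Prop
  | .rel R z, v => (⟨R, fun i => (v (z i) : Value)⟩ : Fact S) ∈ D
  | .notRel R z, v => (⟨R, fun i => (v (z i) : Value)⟩ : Fact S) ∉ D
  | .ne i j, v => v i ≠ v j

/-- EML formulas `φ(x)`. In `ex m lits p var sub`, which stands for `∃ y₁ … yₘ ψ(x, y₁, …, yₘ)`,
variable `0` is `x`, the other variables are `y₁, …, yₘ`, and `ψ` is the conjunction of
the literals `lits` and of the unary formulas `(sub j)(var j)` for `j < p`. -/
inductive EMLFormula (S : Schema) : Type where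
  | not (φ : EMLFormula S) : EMLFormula S
  | or (φ ψ : EMLFormula S) : EMLFormula S
  | ex (m : ℕ) (lits : List (EMLLiteral S (m + 1))) (p : ℕ) (var : Fin p → Fin (m + 1))
      (sub : Fin p → EMLFormula S) : EMLFormula S

/-- Satisfaction of an EML formula at a value. -/
def EMLFormula.Sat {S : Schema} (D : Database S) : EMLFormula S → adom D → Prop
  | .not φ, x => ¬ φ.Sat D x
  | .or φ ψ, x => φ.Sat D x ∨ ψ.Sat D x
  | .ex m lits p var sub, x => ∃ y : Fin m → adom D,
      (∀ l ∈ lits, l.Sat D (Fin.cons x y : Fin (m + 1) → adom D)) ∧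
        ∀ j : Fin p, (sub j).Sat D ((Fin.cons x y : Fin (m + 1) → adom D) (var j))

/-- EML formulas as value classifiers. -/
def EML : Formalism := fun S =>
  { Classifier := EMLFormula S, accepts := fun φ X => φ.Sat X.db X.point }

/-! ### Separating properties -/

/-- The graph schema: one binary symbol. -/
abbrev graphSchema : Schema where
  Rel := Unit
  finite := inferInstance
  arity := fun _ => 2

/-- Local transitivity: `(v, u₁) ∈ E` and `(u₁, u₂) ∈ E` imply `(v, u₂) ∈ E`. -/
def LocallyTransitive : ValueProperty graphSchema :=
  {X | ∀ u₁ u₂ : Value, (⟨(), ![X.pt, u₁]⟩ : Fact graphSchema) ∈ X.db →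
    (⟨(), ![u₁, u₂]⟩ : Fact graphSchema) ∈ X.db → (⟨(), ![X.pt, u₂]⟩ : Fact graphSchema) ∈ X.db}

/-- The symbols of the schema of directed graphs with three unary relations. -/
inductive PQRSymbol where
  | E
  | P
  | Q
  | R

instance : Finite PQRSymbol :=
  Finite.of_injective (fun s => (match s with | .E => 0 | .P => 1 | .Q => 2 | .R => 3 : Fin 4))
    (by intro a b h; cases a <;> cases b <;> simp_all)

/-- A binary symbol `E` and unary symbols `P`, `Q`, `R`. -/
abbrev pqrSchema : Schema where
  Rel := PQRSymbol
  finite := inferInstance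
  arity := fun s => match s with
    | .E => 2
    | .P => 1
    | .Q => 1
    | .R => 1

/-- `v` and its descendants (the vertices reachable from `v`) form a reflexive linear order
`v = v₀, …, vₙ` with `n mod 3 = 2`, in which `vᵢ` satisfies exactly `P`, `Q` or `R`, according to
`i mod 3`. -/
def PQROrder : ValueProperty pqrSchema :=
  {X | ∃ (n : ℕ) (f : Fin (n + 1) → Value),
    n % 3 = 2 ∧ f 0 = X.pt ∧ Function.Injective f ∧
    (∀ u : Value, u ∈ Set.range f ↔
      Relation.ReflTransGen (fun a b => (⟨.E, ![a, b]⟩ : Fact pqrSchema) ∈ X.db) X.pt u) ∧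
    (∀ i j : Fin (n + 1), (⟨.E, ![f i, f j]⟩ : Fact pqrSchema) ∈ X.db ↔ i ≤ j) ∧
    ∀ i : Fin (n + 1),
      ((⟨.P, ![f i]⟩ : Fact pqrSchema) ∈ X.db ↔ (i : ℕ) % 3 = 0) ∧
      ((⟨.Q, ![f i]⟩ : Fact pqrSchema) ∈ X.db ↔ (i : ℕ) % 3 = 1) ∧
      ((⟨.R, ![f i]⟩ : Fact pqrSchema) ∈ X.db ↔ (i : ℕ) % 3 = 2)}

end DeepNet

open DeepNet

namespace DeepNet

/-! ### Definable node maps -/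

/-! Networks and logics are compared through maps that give every value of every database a label in
some type. A notion of definability for such maps that is closed under constants, post-composition,
pairing and a single query contains all feature maps of networks (`Definability.features`).
Simulating a network therefore comes down to simulating one query.

The common currency is the atomic type of a tuple. Over finitely many variables there are finitely
many types. The tuples of a realised type are the embeddings of a pattern
(`representable_atomicType`), and the tuples satisfying a set of positive atoms are the
homomorphisms of a pattern (`representable_atoms`).

For sum, a homomorphism query splits into embedding queries, one per type (`Computable.sum_emb`),
and an embedding query arises from homomorphism queries by inclusion-exclusion over its negative
literals (`Computable.sum_hom`).

For max, features take finitely many values, and a query depends only on which label tuples occur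
along its mappings, which EML can say (`emlDefinability_patternAgg_maxAgg`). Conversely, with
weights 0 and 1 both aggregations detect whether a mapping exists, so embedding networks evaluate
EML (`EMLFormula.computable`). Between UQAFO and EML, a block of existential quantifiers is a finite
disjunction over types with unary labels, negation exchanges the two kinds of formulas, and unary
alternation corresponds to nested EML subformulas.

For the separations, PQR-order is a local condition on out-degrees modulo 3 (`mem_pqrOrder_iff`),
and sums count out-degrees. EML fails by an Ehrenfeucht–Fraïssé argument: far from the ends of a
long word it sees only the letter at a position (`exists_similar_embedding`), so one wrong letter in
the middle goes unnoticed. Max-DHNs cannot separate reflexive graphs, where constant maps are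
homomorphisms (`features_hom_maxAgg_eq`), while local transitivity can differ on such graphs. -/

/-- A notion of definability for maps on the values of databases that is closed under constants,
post-composition and pairing. -/
structure Definability (S : Schema) where
  Def : ∀ {α : Type}, ((D : Database S) → adom D → α) → Prop
  const : ∀ {α : Type} (a : α), Def fun _ _ => a
  map : ∀ {α β : Type} {g : (D : Database S) → adom D → α} (f : α → β), Def g →
    Def fun D u => f (g D u)
  pair : ∀ {α β : Type} {g : (D : Database S) → adom D → α} {g' : (D : Database S) → adom D → β},
    Def g → Def g' → Def fun D u => (g D u, g' D u)

namespace Definability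

variable {S : Schema} (C : Definability S)

theorem pi_fin : ∀ {n : ℕ} {β : Fin n → Type} {g : ∀ j, (D : Database S) → adom D → β j},
    (∀ j, C.Def (g j)) → C.Def fun D u j => g j D u
  | 0, β, _, _ => by
    have h := C.const (α := ∀ j : Fin 0, β j) fun j => j.elim0
    convert h using 3
  | n + 1, β, g, hg => by
    have h := C.map (fun p : β 0 × (∀ j : Fin n, β j.succ) => (Fin.cons p.1 p.2 : ∀ j, β j))
      (C.pair (hg 0) (pi_fin fun j => hg j.succ))
    convert h using 3 with D u
    funext j
    refine Fin.cases ?_ (fun j => ?_) j <;> simp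

theorem pi {J : Type} [Finite J] {β : Type} {g : J → (D : Database S) → adom D → β}
    (hg : ∀ j, C.Def (g j)) : C.Def fun D u j => g j D u := by
  have e := Finite.equivFin J
  have h := C.map (fun (f : Fin (Nat.card J) → β) j => f (e j))
    (C.pi_fin fun j => hg (e.symm j))
  simpa using h

theorem map₂ {α β γ : Type} {g : (D : Database S) → adom D → α}
    {g' : (D : Database S) → adom D → β} (f : α → β → γ) (hg : C.Def g) (hg' : C.Def g') :
    C.Def fun D u => f (g D u) (g' D u) :=
  C.map (fun p : α × β => f p.1 p.2) (C.pair hg hg')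

theorem sum {J : Type} [Fintype J] {g : J → (D : Database S) → adom D → ℝ}
    (hg : ∀ j, C.Def (g j)) : C.Def fun D u => ∑ j, g j D u :=
  C.map (fun f : J → ℝ => ∑ j, f j) (C.pi hg)

theorem exists_index {J : Type} [Finite J] {P : J → (D : Database S) → adom D → Prop}
    (hP : ∀ j, C.Def (P j)) : C.Def fun D u => ∃ j, P j D u :=
  C.map (fun f : J → Prop => ∃ j, f j) (C.pi hP)

end Definability

/-! ### Queries with transformations on arbitrary labels -/

open Classical in
/-- The aggregate, over the mappings of a pattern, of the products of the weights `w` of the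
labels `g`. -/
noncomputable def patternAgg {S : Schema} {α : Type} (k : MapKind) (agg : Aggregation)
    (F : Pattern S) (w : F.dom → α → ℝ) (g : (D : Database S) → adom D → α)
    (D : Database S) (u : adom D) : ℝ :=
  agg ((Finset.univ.filter fun h : F.dom → adom D => k.IsMap F D u h).val.map
    fun h => ∏ x, w x (g D (h x)))

open Classical in
/-- The aggregate of the products of the weights `w` of the labels `g` over the assignments that
satisfy `Q` and send `i₀` to the given value. -/
noncomputable def assignmentAgg {S : Schema} {α ι : Type} [Fintype ι] (agg : Aggregation)
    (Q : (D : Database S) → (ι → adom D) → Prop) (i₀ : ι) (w : ι → α → ℝ)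
    (g : (D : Database S) → adom D → α) (D : Database S) (u : adom D) : ℝ :=
  agg ((Finset.univ.filter fun h : ι → adom D => h i₀ = u ∧ Q D h).val.map
    fun h => ∏ i, w i (g D (h i)))

/-- The map `q` from variables to the values of `F` identifies the mappings of `F` of kind `k` with
the assignments that satisfy `Q`. -/
structure Represents {S : Schema} {ι : Type} (k : MapKind) (F : Pattern S) (q : ι → F.dom)
    (i₀ : ι) (Q : (D : Database S) → (ι → adom D) → Prop) : Prop where
  surj : Function.Surjective q
  iff : ∀ (D : Database S) (u : adom D) (h : ι → adom D),
    (h i₀ = u ∧ Q D h) ↔ ∃ h' : F.dom → adom D, k.IsMap F D u h' ∧ h = h' ∘ q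

/-- `Q` is represented by some pattern. -/
def Representable {S : Schema} {ι : Type} (k : MapKind) (i₀ : ι)
    (Q : (D : Database S) → (ι → adom D) → Prop) : Prop :=
  ∃ (F : Pattern S) (q : ι → F.dom), Represents k F q i₀ Q

-- Composition with the surjection `q` is a bijection from mappings to assignments. Variables that
-- `q` identifies take the same value, so their weights multiply into one transformation function.
open Classical in
theorem Represents.assignmentAgg_eq {S : Schema} {α ι : Type} [Fintype ι] {k : MapKind}
    {F : Pattern S} {q : ι → F.dom} {i₀ : ι} {Q : (D : Database S) → (ι → adom D) → Prop}
    (H : Represents k F q i₀ Q) (agg : Aggregation) (w : ι → α → ℝ)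
    (g : (D : Database S) → adom D → α) :
    assignmentAgg agg Q i₀ w g =
      patternAgg k agg F (fun x a => ∏ i with q i = x, w i a) g := by
  funext D u
  unfold assignmentAgg patternAgg
  have hinj : Function.Injective fun h' : F.dom → adom D => h' ∘ q :=
    fun a b hab => H.surj.injective_comp_right hab
  have himg : (Finset.univ.filter fun h : ι → adom D => h i₀ = u ∧ Q D h) =
      (Finset.univ.filter fun h : F.dom → adom D => k.IsMap F D u h).map ⟨_, hinj⟩ := by
    ext h
    rw [Finset.mem_filter, and_iff_right (Finset.mem_univ _), H.iff D u h]
    simp only [Finset.mem_filter, Finset.mem_univ, true_and, Finset.mem_map,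
      Function.Embedding.coeFn_mk, eq_comm]
  rw [himg, Finset.map_val, Multiset.map_map]
  congr 1
  refine Multiset.map_congr rfl fun h _ => ?_
  simp only [Function.comp_apply, Function.Embedding.coeFn_mk]
  rw [← Finset.prod_fiberwise (s := Finset.univ) (g := q)]
  refine Finset.prod_congr rfl fun x _ => Finset.prod_congr rfl fun i hi => ?_
  rw [(Finset.mem_filter.mp hi).2]

/-- A definability notion that is closed under the queries of a kind of network contains all the
feature maps of such networks. -/
theorem Definability.features {S : Schema} (C : Definability S) (k : MapKind) (agg : Aggregation)
    (hC : ∀ {α : Type} (F : Pattern S) (w : F.dom → α → ℝ) (g : (D : Database S) → adom D → α),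
      C.Def g → C.Def (patternAgg k agg F w g)) {d : ℕ} (Ls : LayerSeq S d) :
    C.Def fun D u => Ls.features k agg D u := by
  induction Ls with
  | nil => exact C.const _
  | snoc Ls L ih =>
    exact C.map L.com (C.pi_fin fun j => C.pi_fin fun i =>
      hC (L.query j).pattern (fun x a => (L.query j).trans x a i) _ ih)

/-! ### Maps computed by networks -/

/-- `g` is obtained from the features computed by some sequence of layers. -/
def Computable {S : Schema} {α : Type} (k : MapKind) (agg : Aggregation)
    (g : (D : Database S) → adom D → α) : Prop :=
  ∃ (d : ℕ) (Ls : LayerSeq S d) (c : (Fin d → ℝ) → α),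
    ∀ D u, g D u = c (Ls.features k agg D u)

theorem Computable.map {S : Schema} {α β : Type} {k : MapKind} {agg : Aggregation}
    {g : (D : Database S) → adom D → α} (f : α → β) (hg : Computable k agg g) :
    Computable k agg fun D u => f (g D u) := by
  obtain ⟨d, Ls, c, h⟩ := hg
  exact ⟨d, Ls, f ∘ c, fun D u => congrArg f (h D u)⟩

/-- One more layer suffices: transformation functions are arbitrary, so they absorb the decoding `c`
of real features into labels of type `α`. -/
theorem Computable.queries {S : Schema} {α J : Type} [Finite J] {k : MapKind} {agg : Aggregation}
    {g : (D : Database S) → adom D → α} (hg : Computable k agg g) (F : J → Pattern S)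
    (w : ∀ j, (F j).dom → α → ℝ) :
    Computable k agg fun D u j => patternAgg k agg (F j) (w j) g D u := by
  obtain ⟨d, Ls, c, h⟩ := hg
  have e := Finite.equivFin J
  let L : Layer S d (Nat.card J) :=
    { numQueries := Nat.card J
      query := fun j =>
        { pattern := F (e.symm j)
          outDim := 1
          outDim_pos := one_pos
          trans := fun x v _ => w (e.symm j) x (c v) }
      com := fun r j => r j 0 }
  refine ⟨_, Ls.snoc L, fun v j => v (e j), fun D u => funext fun j => ?_⟩
  -- The type of `w j` depends on `j`, so `e.symm (e j)` cannot be rewritten in place; the index is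
  -- generalised first.
  have key : ∀ j', j' = j → patternAgg k agg (F j) (w j) g D u =
      patternAgg k agg (F j') (w j') (fun D u => c (Ls.features k agg D u)) D u := by
    rintro _ rfl
    congr 1
    funext D u
    exact h D u
  exact key _ (e.symm_apply_apply j)

theorem Computable.query {S : Schema} {α : Type} {k : MapKind} {agg : Aggregation}
    {g : (D : Database S) → adom D → α} (hg : Computable k agg g) (F : Pattern S)
    (w : F.dom → α → ℝ) : Computable k agg (patternAgg k agg F w g) :=
  (hg.queries (J := Unit) (fun _ => F) fun _ => w).map fun f => f ()

theorem Computable.assignmentAgg {S : Schema} {α ι : Type} [Fintype ι] {k : MapKind}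
    {agg : Aggregation} {g : (D : Database S) → adom D → α} (hg : Computable k agg g) {i₀ : ι}
    {Q : (D : Database S) → (ι → adom D) → Prop} (hQ : Representable k i₀ Q) (w : ι → α → ℝ) :
    Computable k agg (assignmentAgg agg Q i₀ w g) := by
  obtain ⟨F, q, H⟩ := hQ
  rw [H.assignmentAgg_eq]
  exact hg.query F _

theorem Computable.iff_expresses {S : Schema} {k : MapKind} {agg : Aggregation}
    {P : ValueProperty S} :
    (∃ N : Network S, ∀ X : PointedDatabase S, X ∈ P ↔ N.Accepts k agg X) ↔
      ∃ g : (D : Database S) → adom D → Prop, Computable k agg g ∧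
        ∀ X : PointedDatabase S, X ∈ P ↔ g X.db X.point := by
  classical
  constructor
  · rintro ⟨N, hN⟩
    exact ⟨fun D u => N.cls (N.layers.features k agg D u) = true,
      ⟨_, N.layers, fun v => N.cls v = true, fun _ _ => rfl⟩, hN⟩
  · rintro ⟨g, ⟨d, Ls, c, h⟩, hg⟩
    refine ⟨⟨d, Ls, fun v => decide (c v)⟩, fun X => ?_⟩
    rw [hg, h]
    simp [Network.Accepts]

/-! ### Atomic types -/

/-- Atomic formulas, including equalities, over the variables `ι`. -/
inductive Atom (S : Schema) (ι : Type) : Type where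
  | rel (R : S.Rel) (z : Fin (S.arity R) → ι) : Atom S ι
  | eq (i j : ι) : Atom S ι

/-- Satisfaction of atomic formulas. -/
def Atom.Holds {S : Schema} {ι : Type} (D : Database S) (h : ι → adom D) : Atom S ι → Prop
  | .rel R z => (⟨R, fun i => (h (z i) : Value)⟩ : Fact S) ∈ D
  | .eq i j => h i = h j

/-- Renaming of variables. -/
def Atom.map {S : Schema} {ι κ : Type} (f : ι → κ) : Atom S ι → Atom S κ
  | .rel R z => .rel R (f ∘ z)
  | .eq i j => .eq (f i) (f j)

theorem Atom.holds_map {S : Schema} {ι κ : Type} (f : ι → κ) {D : Database S} (h : κ → adom D)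
    (a : Atom S ι) : (a.map f).Holds D h ↔ a.Holds D (h ∘ f) := by
  cases a <;> rfl

instance {S : Schema} {ι : Type} [Finite ι] : Finite (Atom S ι) := by
  have := S.finite
  refine Finite.of_injective (β := (Σ R : S.Rel, Fin (S.arity R) → ι) ⊕ (ι × ι))
    (fun a => match a with
      | .rel R z => Sum.inl ⟨R, z⟩
      | .eq i j => Sum.inr (i, j)) ?_
  rintro (⟨R, z⟩ | ⟨i, j⟩) (⟨R', z'⟩ | ⟨i', j'⟩) h
  · simp only [Sum.inl.injEq, Sigma.mk.injEq] at h
    obtain ⟨rfl, h⟩ := h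
    rw [eq_of_heq h]
  · simp at h
  · simp at h
  · simp only [Sum.inr.injEq, Prod.mk.injEq] at h
    rw [h.1, h.2]

/-- The atomic type of an assignment: the set of atomic formulas that it satisfies. -/
def atomicType {S : Schema} {ι : Type} (D : Database S) (h : ι → adom D) : Set (Atom S ι) :=
  {a | a.Holds D h}

theorem holds_iff_of_atomicType_eq {S : Schema} {ι : Type} {D D' : Database S} {h : ι → adom D}
    {h' : ι → adom D'} (e : atomicType D h = atomicType D' h') (a : Atom S ι) :
    a.Holds D h ↔ a.Holds D' h' :=
  Set.ext_iff.mp e a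

theorem atomicType_comp {S : Schema} {ι κ : Type} (f : ι → κ) {D D' : Database S} {h : κ → adom D}
    {h' : κ → adom D'} (e : atomicType D h = atomicType D' h') :
    atomicType D (h ∘ f) = atomicType D' (h' ∘ f) := by
  ext a
  exact (Atom.holds_map f h a).symm.trans
    ((holds_iff_of_atomicType_eq e _).trans (Atom.holds_map f h' a))

theorem mem_adom {S : Schema} {D : Database S} {a : Value} :
    a ∈ adom D ↔ ∃ f ∈ D, ∃ i, f.args i = a := by
  simp [adom]

open Classical in
/-- The restriction of a database to the values of an assignment. -/
noncomputable def restrictPattern {S : Schema} {ι : Type} [Fintype ι] (D : Database S)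
    (h : ι → adom D) (i₀ : ι) : Pattern S where
  db := D.filter fun f => ∀ j, f.args j ∈ Finset.univ.image fun i => (h i : Value)
  dom := Finset.univ.image fun i => (h i : Value)
  adom_subset := by
    intro a ha
    obtain ⟨f, hf, j, rfl⟩ := mem_adom.mp ha
    exact (Finset.mem_filter.mp hf).2 j
  pt := h i₀
  pt_mem := Finset.mem_image_of_mem _ (Finset.mem_univ i₀)

/-- The assignments of a realised atomic type are the embeddings of a pattern. -/
theorem representable_atomicType {S : Schema} {ι : Type} [Finite ι] (i₀ : ι) (D₀ : Database S)
    (h₀ : ι → adom D₀) :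
    Representable .emb i₀ fun D h => atomicType D h = atomicType D₀ h₀ := by
  classical
  have := Fintype.ofFinite ι
  let F := restrictPattern D₀ h₀ i₀
  let q : ι → F.dom := fun i => ⟨h₀ i, Finset.mem_image_of_mem _ (Finset.mem_univ i)⟩
  have hq : Function.Surjective q := by
    rintro ⟨a, ha⟩
    obtain ⟨i, -, rfl⟩ := Finset.mem_image.mp ha
    exact ⟨i, rfl⟩
  have hmem : ∀ (R : S.Rel) (z : Fin (S.arity R) → ι),
      (⟨R, fun i => (q (z i) : Value)⟩ : Fact S) ∈ F.db ↔
        (⟨R, fun i => (h₀ (z i) : Value)⟩ : Fact S) ∈ D₀ := by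
    intro R z
    refine Finset.mem_filter.trans (and_iff_left fun j => ?_)
    exact Finset.mem_image_of_mem _ (Finset.mem_univ (z j))
  have hqq : ∀ i j, q i = q j ↔ h₀ i = h₀ j := fun i j => by
    simp only [q, Subtype.ext_iff]
  refine ⟨F, q, hq, fun D u h => ⟨?_, ?_⟩⟩
  · rintro ⟨hu, ht⟩
    have heq : ∀ i j, h i = h j ↔ q i = q j := fun i j =>
      (holds_iff_of_atomicType_eq ht (.eq i j)).trans (hqq i j).symm
    -- The choice of a preimage is harmless: by `heq`, `h` agrees on variables with the same image
    -- under `q`.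
    let h' : F.dom → adom D := fun x => h (hq x).choose
    have hh' : ∀ i, h' (q i) = h i := fun i => (heq _ _).mpr (hq (q i)).choose_spec
    have hfact : ∀ (R : S.Rel) (t : Fin (S.arity R) → F.dom),
        (⟨R, fun i => (t i : Value)⟩ : Fact S) ∈ F.db ↔
          (⟨R, fun i => (h' (t i) : Value)⟩ : Fact S) ∈ D := by
      intro R t
      choose z hz using fun i => hq (t i)
      obtain rfl : t = fun i => q (z i) := funext fun i => (hz i).symm
      simp only [hh']
      exact (hmem R z).trans (holds_iff_of_atomicType_eq ht (.rel R z)).symm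
    refine ⟨h', ⟨⟨(hh' i₀).trans hu, fun R t => (hfact R t).mp⟩, ?_, fun R t => (hfact R t).mpr⟩,
      funext fun i => (hh' i).symm⟩
    intro x y hxy
    obtain ⟨i, rfl⟩ := hq x
    obtain ⟨j, rfl⟩ := hq y
    rw [hh', hh'] at hxy
    exact (heq i j).mp hxy
  · rintro ⟨h', ⟨⟨hu, hhom⟩, hinj, hrefl⟩, rfl⟩
    refine ⟨hu, ?_⟩
    ext a
    cases a with
    | rel R z =>
      refine Iff.trans ⟨fun H => ?_, fun H => ?_⟩ (hmem R z)
      · exact hrefl R (fun i => q (z i)) H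
      · exact hhom R (fun i => q (z i)) H
    | eq i j => exact hinj.eq_iff.trans (hqq i j)

/-- The assignments that satisfy a set of atomic formulas are the homomorphisms of a pattern. -/
theorem representable_atoms {S : Schema} {ι : Type} [Finite ι] (i₀ : ι) (A : Set (Atom S ι)) :
    Representable .hom i₀ fun D h => ∀ a ∈ A, a.Holds D h := by
  classical
  have := Fintype.ofFinite ι
  -- Equality atoms cannot be stated by the facts of a pattern, so variables are merged along the
  -- equivalence they generate, and the classes, numbered by naturals, become the values of the
  -- pattern.
  let s : Setoid ι := Relation.EqvGen.setoid fun i j => Atom.eq i j ∈ A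
  obtain ⟨n, ⟨e⟩⟩ := Finite.exists_equiv_fin (Quotient s)
  let c : ι → Value := fun i => e (Quotient.mk s i)
  have hc : ∀ i j, c i = c j ↔ Relation.EqvGen (fun i j => Atom.eq i j ∈ A) i j := by
    intro i j
    simp only [c, Fin.val_inj, EmbeddingLike.apply_eq_iff_eq]
    exact Quotient.eq
  let f : Atom S ι → Database S := fun a => match a with
    | .rel R z => {⟨R, fun i => c (z i)⟩}
    | .eq _ _ => ∅
  let F : Pattern S :=
    { db := (Set.toFinite A).toFinset.biUnion f
      dom := Finset.univ.image c
      adom_subset := by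
        intro a ha
        obtain ⟨φ, hφ, j, rfl⟩ := mem_adom.mp ha
        obtain ⟨b, -, hb⟩ := Finset.mem_biUnion.mp hφ
        cases b with
        | rel R z =>
          obtain rfl := Finset.mem_singleton.mp hb
          exact Finset.mem_image_of_mem _ (Finset.mem_univ _)
        | eq i j => simp [f] at hb
      pt := c i₀
      pt_mem := Finset.mem_image_of_mem _ (Finset.mem_univ i₀) }
  have hmem : ∀ φ : Fact S, φ ∈ F.db ↔ ∃ R z, Atom.rel R z ∈ A ∧ φ = ⟨R, fun i => c (z i)⟩ := by
    intro φ
    refine Finset.mem_biUnion.trans ⟨?_, ?_⟩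
    · rintro ⟨b, hb, hφ⟩
      cases b with
      | rel R z => exact ⟨R, z, (Set.Finite.mem_toFinset _).mp hb, Finset.mem_singleton.mp hφ⟩
      | eq i j => simp [f] at hφ
    · rintro ⟨R, z, hA, rfl⟩
      exact ⟨_, (Set.Finite.mem_toFinset _).mpr hA, Finset.mem_singleton_self _⟩
  let q : ι → F.dom := fun i => ⟨c i, Finset.mem_image_of_mem _ (Finset.mem_univ i)⟩
  have hq : Function.Surjective q := by
    rintro ⟨a, ha⟩
    obtain ⟨i, -, rfl⟩ := Finset.mem_image.mp ha
    exact ⟨i, rfl⟩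
  refine ⟨F, q, hq, fun D u h => ⟨?_, ?_⟩⟩
  · rintro ⟨hu, hA⟩
    have hgen : ∀ i j, c i = c j → h i = h j := by
      intro i j hij
      have := (hc i j).mp hij
      induction this with
      | rel i j hr => exact hA _ hr
      | refl => rfl
      | symm i j _ ih => exact (ih ((hc _ _).mpr ‹_›)).symm
      | trans i j k _ _ ih₁ ih₂ => exact (ih₁ ((hc _ _).mpr ‹_›)).trans (ih₂ ((hc _ _).mpr ‹_›))
    let h' : F.dom → adom D := fun x => h (hq x).choose
    have hh' : ∀ (x : F.dom) i, (x : Value) = c i → h' x = h i := fun x i hx =>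
      hgen _ _ ((congrArg Subtype.val (hq x).choose_spec).trans hx)
    refine ⟨h', ⟨(hh' _ i₀ rfl).trans hu, fun R t ht => ?_⟩, funext fun i => (hh' _ i rfl).symm⟩
    obtain ⟨R', z, hz, e⟩ := (hmem _).mp ht
    obtain rfl : R = R' := congrArg Fact.rel e
    have e' : (fun i => (t i : Value)) = fun i => c (z i) := by simpa using e
    have : ∀ i, h' (t i) = h (z i) := fun i => hh' _ _ (congrFun e' i)
    simp only [this]
    exact hA _ hz
  · rintro ⟨h', ⟨hu, hhom⟩, rfl⟩
    refine ⟨hu, fun a ha => ?_⟩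
    cases a with
    | rel R z => exact hhom R (fun i => q (z i)) ((hmem _).mpr ⟨R, z, ha, rfl⟩)
    | eq i j => exact congrArg h' (Subtype.ext ((hc i j).mpr (.rel _ _ ha)))


/-! ### Networks form a definability notion -/

/-- The properties of sum and max aggregation that make networks closed under pairing and allow
them to test for the existence of a mapping. -/
structure RegularAggregation (agg : Aggregation) : Prop where
  zero : agg 0 = 0
  singleton : ∀ a, agg {a} = a
  ne_zero_iff : ∀ M : Multiset ℝ, (∀ x ∈ M, x = 0 ∨ x = 1) → (agg M ≠ 0 ↔ (1 : ℝ) ∈ M)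

theorem regularAggregation_sumAgg : RegularAggregation sumAgg where
  zero := Multiset.sum_zero
  singleton := Multiset.sum_singleton
  ne_zero_iff := by
    intro M hM
    have hnn : ∀ x ∈ M, (0 : ℝ) ≤ x := fun x hx => by
      rcases hM x hx with rfl | rfl <;> norm_num
    constructor
    · intro h
      by_contra h1
      refine h (Multiset.sum_eq_zero fun x hx => (hM x hx).resolve_right ?_)
      rintro rfl
      exact h1 hx
    · intro h1 h
      have := Multiset.single_le_sum hnn 1 h1
      have h' : M.sum = 0 := h
      linarith

theorem regularAggregation_maxAgg : RegularAggregation maxAgg where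
  zero := by simp [maxAgg]
  singleton := fun a => by simp [maxAgg]
  ne_zero_iff := by
    intro M hM
    rcases M.toFinset.eq_empty_or_nonempty with h | h
    · have h0 : M = 0 := Multiset.toFinset_eq_empty.mp h
      subst h0
      simp [maxAgg]
    · have hmax : maxAgg M = M.toFinset.max' h := by
        simp [maxAgg, ← Finset.coe_max' h]
      rw [hmax]
      have hmem := Multiset.mem_toFinset.mp (M.toFinset.max'_mem h)
      constructor
      · intro hne
        exact (hM _ hmem).resolve_left hne ▸ hmem
      · intro h1
        have := M.toFinset.le_max' 1 (Multiset.mem_toFinset.mpr h1)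
        intro h0
        linarith

/-- These queries pass a feature on unchanged. A fact-free single point does so for homomorphisms.
An embedding also reflects facts, so there one query is needed for each realised type of a single
value, and exactly one of them fires. -/
theorem exists_identity_queries (S : Schema) (k : MapKind) :
    ∃ (J : Type) (_ : Fintype J) (Q : J → (D : Database S) → (Unit → adom D) → Prop),
      (∀ j, Representable k () (Q j)) ∧ ∀ D h, ∃! j, Q j D h := by
  cases k with
  | hom =>
    exact ⟨Unit, inferInstance, fun _ D h => ∀ a ∈ (∅ : Set (Atom S Unit)), a.Holds D h,
      fun _ => representable_atoms () ∅, fun D h => ⟨(), by simp, fun _ _ => rfl⟩⟩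
  | emb =>
    refine ⟨{τ : Set (Atom S Unit) // ∃ D, ∃ h : Unit → adom D, atomicType D h = τ},
      Fintype.ofFinite _, fun τ D h => atomicType D h = τ, ?_, fun D h => ?_⟩
    · rintro ⟨_, D, h, rfl⟩
      exact representable_atomicType () D h
    · exact ⟨⟨_, D, h, rfl⟩, rfl, fun τ hτ => Subtype.ext hτ.symm⟩

theorem assignmentAgg_eq {S : Schema} {α ι : Type} [Fintype ι] {agg : Aggregation}
    {Q : (D : Database S) → (ι → adom D) → Prop} {i₀ : ι} {w : ι → α → ℝ}
    {g : (D : Database S) → adom D → α} {D : Database S} {u : adom D}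
    {s : Finset (ι → adom D)} (hs : ∀ h, h ∈ s ↔ h i₀ = u ∧ Q D h) :
    assignmentAgg agg Q i₀ w g D u = agg (s.val.map fun h => ∏ i, w i (g D (h i))) := by
  classical
  unfold assignmentAgg
  congr 3
  ext h
  simp [hs]

theorem assignmentAgg_unit {S : Schema} {α : Type} {agg : Aggregation} (ha : RegularAggregation agg)
    (Q : (D : Database S) → (Unit → adom D) → Prop) (w : Unit → α → ℝ)
    (g : (D : Database S) → adom D → α) (D : Database S) (u : adom D) [Decidable (Q D fun _ => u)] :
    assignmentAgg agg Q () w g D u = if Q D (fun _ => u) then w () (g D u) else 0 := by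
  classical
  have hfun : ∀ h : Unit → adom D, h () = u ↔ h = fun _ => u := fun h =>
    ⟨fun e => funext fun _ => e, fun e => congrFun e ()⟩
  split_ifs with hQ
  · rw [assignmentAgg_eq (s := {fun _ => u})]
    · simp [ha.singleton]
    · intro h
      rw [Finset.mem_singleton, hfun]
      exact (and_iff_left_of_imp fun e => e ▸ hQ).symm
  · rw [assignmentAgg_eq (s := ∅)]
    · simp [ha.zero]
    · intro h
      simp only [hfun, Finset.notMem_empty, false_iff, not_and]
      exact fun e => e ▸ hQ

/-- The two networks run one after the other: the layers of `Ls'` are stacked on top of `Ls`, and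
identity queries carry the features of `Ls` through each of them. Summing over `j` recovers the
feature, because the identity queries that do not fire return `agg 0 = 0`. -/
theorem Computable.features_pair {S : Schema} {k : MapKind} {agg : Aggregation}
    (ha : RegularAggregation agg) {d e : ℕ} (Ls : LayerSeq S d) (Ls' : LayerSeq S e) :
    Computable k agg fun D u => (Ls.features k agg D u, Ls'.features k agg D u) := by
  classical
  induction Ls' with
  | nil => exact ⟨d, Ls, fun v => (v, Fin.elim0), fun _ _ => rfl⟩
  | @snoc e e' Ls' L ih =>
    obtain ⟨J, _, Q, hQ, huniq⟩ := exists_identity_queries S k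
    choose F q H using hQ
    have key := ih.queries (J := (J × Fin d) ⊕ (Σ j : Fin L.numQueries, Fin (L.query j).outDim))
      (fun j => match j with
        | .inl p => F p.1
        | .inr p => (L.query p.1).pattern)
      (fun j => match j with
        | .inl p => fun x a => ∏ i with q p.1 i = x, a.1 p.2
        | .inr p => fun x a => (L.query p.1).trans x a.2 p.2)
    have key' := key.map fun r =>
      ((fun i => ∑ j, r (.inl (j, i)), L.com fun j i => r (.inr ⟨j, i⟩)) :
        (Fin d → ℝ) × (Fin e' → ℝ))
    convert key' using 4 with D u
    swap
    · rfl
    funext i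
    have hj : ∀ j, patternAgg k agg (F j)
        (fun x (a : (Fin d → ℝ) × (Fin e → ℝ)) => ∏ i' with q j i' = x, a.1 i)
        (fun D u => (Ls.features k agg D u, Ls'.features k agg D u)) D u =
          if Q j D (fun _ => u) then Ls.features k agg D u i else 0 := by
      intro j
      rw [← assignmentAgg_unit ha (Q j) (fun _ (a : (Fin d → ℝ) × (Fin e → ℝ)) => a.1 i)
        (fun D u => (Ls.features k agg D u, Ls'.features k agg D u)) D u,
        (H j).assignmentAgg_eq]
    obtain ⟨j₀, hj₀, hj₀'⟩ := huniq D fun _ => u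
    refine Eq.trans ?_ (Finset.sum_congr rfl fun j _ => (hj j).symm)
    rw [Finset.sum_eq_single j₀, if_pos hj₀]
    · intro j _ hne
      exact if_neg fun hQ => hne (hj₀' j hQ)
    · simp

/-- The definability notion given by networks. -/
def networkDefinability (S : Schema) (k : MapKind) {agg : Aggregation}
    (ha : RegularAggregation agg) : Definability S where
  Def := Computable k agg
  const a := ⟨0, .nil, fun _ => a, fun _ _ => rfl⟩
  map f h := h.map f
  pair := by
    rintro α β g g' ⟨d, Ls, c, hg⟩ ⟨e, Ls', c', hg'⟩
    have := (Computable.features_pair (k := k) ha Ls Ls').map fun p => (c p.1, c' p.2)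
    simpa only [← hg, ← hg'] using this

/-! ### Sums over assignments -/

/-- `Q` depends only on the atomic type of an assignment. -/
def TypeDetermined {S : Schema} {ι : Type} (Q : (D : Database S) → (ι → adom D) → Prop) : Prop :=
  ∀ (D D' : Database S) (h : ι → adom D) (h' : ι → adom D'),
    atomicType D h = atomicType D' h' → Q D h → Q D' h'

theorem typeDetermined_isMap {S : Schema} (k : MapKind) (F : Pattern S) :
    ∃ Q : (D : Database S) → (F.dom → adom D) → Prop, TypeDetermined Q ∧
      ∀ D u h, k.IsMap F D u h ↔ h ⟨F.pt, F.pt_mem⟩ = u ∧ Q D h := by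
  have hhom : TypeDetermined fun (D : Database S) (h : F.dom → adom D) =>
      ∀ (R : S.Rel) (t : Fin (S.arity R) → F.dom), (⟨R, fun i => (t i : Value)⟩ : Fact S) ∈ F.db →
        (⟨R, fun i => (h (t i) : Value)⟩ : Fact S) ∈ D :=
    fun D D' h h' e H R t ht => (holds_iff_of_atomicType_eq e (.rel R t)).mp (H R t ht)
  cases k with
  | hom => exact ⟨_, hhom, fun D u h => Iff.rfl⟩
  | emb =>
    refine ⟨fun D h => _ ∧ Function.Injective h ∧ ∀ (R : S.Rel) (t : Fin (S.arity R) → F.dom),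
      (⟨R, fun i => (h (t i) : Value)⟩ : Fact S) ∈ D →
        (⟨R, fun i => (t i : Value)⟩ : Fact S) ∈ F.db, ?_, fun D u h => and_assoc⟩
    rintro D D' h h' e ⟨h₁, h₂, h₃⟩
    refine ⟨hhom D D' h h' e h₁, fun i j hij => ?_, fun R t ht => ?_⟩
    · exact h₂ ((holds_iff_of_atomicType_eq e (.eq i j)).mpr hij)
    · exact h₃ R t ((holds_iff_of_atomicType_eq e (.rel R t)).mpr ht)

theorem patternAgg_eq_assignmentAgg {S : Schema} {α : Type} {k : MapKind} {agg : Aggregation}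
    {F : Pattern S} {Q : (D : Database S) → (F.dom → adom D) → Prop}
    (hQ : ∀ D u h, k.IsMap F D u h ↔ h ⟨F.pt, F.pt_mem⟩ = u ∧ Q D h) (w : F.dom → α → ℝ)
    (g : (D : Database S) → adom D → α) :
    patternAgg k agg F w g = assignmentAgg agg Q ⟨F.pt, F.pt_mem⟩ w g := by
  classical
  funext D u
  exact (assignmentAgg_eq fun h => by simp [hQ]).symm

theorem assignmentAgg_sumAgg {S : Schema} {α ι : Type} [Fintype ι]
    (Q : (D : Database S) → (ι → adom D) → Prop) (i₀ : ι) (w : ι → α → ℝ)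
    (g : (D : Database S) → adom D → α) (D : Database S) (u : adom D)
    [∀ h : ι → adom D, Decidable (h i₀ = u ∧ Q D h)] [Fintype (ι → adom D)] :
    assignmentAgg sumAgg Q i₀ w g D u =
      ∑ h : ι → adom D, if h i₀ = u ∧ Q D h then ∏ i, w i (g D (h i)) else 0 := by
  rw [← Finset.sum_filter]
  exact assignmentAgg_eq fun h => by simp

/-- Over embedding sum-networks, sums over all assignments with a type-determined property are
computable. -/
theorem Computable.sum_emb {S : Schema} {α ι : Type} [Fintype ι]
    {g : (D : Database S) → adom D → α} (hg : Computable .emb sumAgg g)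
    {Q : (D : Database S) → (ι → adom D) → Prop} (hQ : TypeDetermined Q) (i₀ : ι)
    (w : ι → α → ℝ) : Computable .emb sumAgg (DeepNet.assignmentAgg sumAgg Q i₀ w g) := by
  classical
  -- Only realised types correspond to patterns. Since `Q` is type-determined, every assignment
  -- satisfying `Q` is counted by exactly one `τ`, and no other assignment is counted.
  let J := {τ : Set (Atom S ι) // ∃ D, ∃ h : ι → adom D, atomicType D h = τ ∧ Q D h}
  have := Fintype.ofFinite J
  have key := (networkDefinability S .emb regularAggregation_sumAgg).sum (J := J)
    (g := fun τ => DeepNet.assignmentAgg sumAgg (fun D h => atomicType D h = τ) i₀ w g) (by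
      rintro ⟨_, D, h, rfl, -⟩
      exact hg.assignmentAgg (representable_atomicType i₀ D h) w)
  refine (congrArg (Computable .emb sumAgg) ?_).mpr key
  funext D u
  simp only [assignmentAgg_sumAgg]
  rw [Finset.sum_comm]
  refine Finset.sum_congr rfl fun h _ => ?_
  by_cases hu : h i₀ = u
  · by_cases hh : Q D h
    · rw [if_pos ⟨hu, hh⟩, Finset.sum_eq_single (⟨_, D, h, rfl, hh⟩ : J)]
      · exact (if_pos ⟨hu, rfl⟩).symm
      · intro τ _ hne
        exact if_neg fun H => hne (Subtype.ext H.2.symm)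
      · simp
    · rw [if_neg fun H => hh H.2, Finset.sum_eq_zero]
      rintro ⟨τ, D', h', e, hh'⟩ -
      exact if_neg fun H => hh (hQ D' D h' h (e.trans H.2.symm) hh')
  · rw [if_neg fun H => hu H.1, Finset.sum_eq_zero]
    exact fun τ _ => if_neg fun H => hu H.1

/-- Over homomorphism sum-networks, sums over all assignments that satisfy given positive and
negative literals are computable. -/
theorem Computable.sum_hom {S : Schema} {α ι : Type} [Fintype ι]
    {g : (D : Database S) → adom D → α} (hg : Computable .hom sumAgg g) (i₀ : ι)
    (w : ι → α → ℝ) (N : List (Atom S ι)) (A : Set (Atom S ι)) :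
    Computable .hom sumAgg (DeepNet.assignmentAgg sumAgg
      (fun D h => (∀ a ∈ A, a.Holds D h) ∧ ∀ b ∈ N, ¬ b.Holds D h) i₀ w g) := by
  classical
  induction N generalizing A with
  | nil =>
    simpa using hg.assignmentAgg (representable_atoms i₀ A) w
  | cons b N ih =>
    -- Inclusion-exclusion: the assignments violating `b` are all those for `A` minus those for `A`
    -- with `b` added.
    have key := (networkDefinability S .hom regularAggregation_sumAgg).map₂ (fun x y : ℝ => x - y)
      (ih A) (ih (insert b A))
    refine (congrArg (Computable .hom sumAgg) ?_).mpr key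
    funext D u
    simp only [assignmentAgg_sumAgg, ← Finset.sum_sub_distrib]
    refine Finset.sum_congr rfl fun h _ => ?_
    by_cases hb : b.Holds D h <;> simp [hb]

theorem Computable.hom_of_emb {S : Schema} {α : Type} {g : (D : Database S) → adom D → α}
    (hg : Computable .emb sumAgg g) : Computable .hom sumAgg g := by
  classical
  obtain ⟨d, Ls, c, h⟩ := hg
  have := (networkDefinability S .hom regularAggregation_sumAgg).features .emb sumAgg ?_ Ls
  · exact funext₂ h ▸ this.map c
  · intro α F w g hg
    -- The diagram of `F`. Embeddings satisfy exactly the atoms in `A`; falsifying the equalities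
    -- outside the diagonal is injectivity, and falsifying the other facts is reflection.
    let A : Set (Atom S F.dom) := {a | match a with
      | .rel R z => (⟨R, fun i => (z i : Value)⟩ : Fact S) ∈ F.db
      | .eq i j => i = j}
    rw [patternAgg_eq_assignmentAgg (Q := fun D h => (∀ a ∈ A, a.Holds D h) ∧
      ∀ b ∈ (Set.toFinite Aᶜ).toFinset.toList, ¬ b.Holds D h)]
    · exact Computable.sum_hom hg _ w _ A
    · intro D u h
      simp only [Finset.mem_toList, Set.Finite.mem_toFinset, Set.mem_compl_iff]
      constructor
      · rintro ⟨⟨hu, hh⟩, hinj, hr⟩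
        refine ⟨hu, fun a ha => ?_, fun b hb hb' => hb ?_⟩
        · cases a with
          | rel R z => exact hh R z ha
          | eq i j => exact congrArg h ha
        · cases b with
          | rel R z => exact hr R z hb'
          | eq i j => exact hinj hb'
      · rintro ⟨hu, hA, hN⟩
        refine ⟨⟨hu, fun R t ht => hA (.rel R t) ht⟩, fun i j hij => ?_, fun R t ht => ?_⟩
        · by_contra hne
          exact hN (.eq i j) hne hij
        · by_contra hne
          exact hN (.rel R t) hne ht

theorem Computable.emb_of_hom {S : Schema} {α : Type} {g : (D : Database S) → adom D → α}
    (hg : Computable .hom sumAgg g) : Computable .emb sumAgg g := by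
  obtain ⟨d, Ls, c, h⟩ := hg
  have := (networkDefinability S .emb regularAggregation_sumAgg).features .hom sumAgg ?_ Ls
  · exact funext₂ h ▸ this.map c
  · intro α F w g hg
    obtain ⟨Q, hQ, hQ'⟩ := typeDetermined_isMap .hom F
    rw [patternAgg_eq_assignmentAgg hQ']
    exact Computable.sum_emb hg hQ _ w

theorem sameExpressivePower_den_dhn_sumAgg : SameExpressivePower (DEN sumAgg) (DHN sumAgg) := by
  constructor
  · intro S P h
    obtain ⟨g, hg, hP⟩ := Computable.iff_expresses.mp h
    exact Computable.iff_expresses.mpr ⟨g, hg.emb_of_hom, hP⟩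
  · intro S P h
    obtain ⟨g, hg, hP⟩ := Computable.iff_expresses.mp h
    exact Computable.iff_expresses.mpr ⟨g, hg.hom_of_emb, hP⟩


/-! ### Definability in embedding modal logic -/

/-- A property of values that is defined by an EML formula. -/
def EMLExpr {S : Schema} (P : (D : Database S) → adom D → Prop) : Prop :=
  ∃ φ : EMLFormula S, ∀ D u, φ.Sat D u ↔ P D u

namespace EMLExpr

variable {S : Schema} {P P' : (D : Database S) → adom D → Prop}

theorem congr (hP : EMLExpr P) (h : ∀ D u, P' D u ↔ P D u) : EMLExpr P' :=
  hP.imp fun _ hφ D u => (hφ D u).trans (h D u).symm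

theorem not (hP : EMLExpr P) : EMLExpr fun D u => ¬ P D u := by
  obtain ⟨φ, hφ⟩ := hP
  exact ⟨.not φ, fun D u => by rw [EMLFormula.Sat, hφ]⟩

theorem or (hP : EMLExpr P) (hP' : EMLExpr P') : EMLExpr fun D u => P D u ∨ P' D u := by
  obtain ⟨φ, hφ⟩ := hP
  obtain ⟨φ', hφ'⟩ := hP'
  exact ⟨.or φ φ', fun D u => by rw [EMLFormula.Sat, hφ, hφ']⟩

theorem and (hP : EMLExpr P) (hP' : EMLExpr P') : EMLExpr fun D u => P D u ∧ P' D u :=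
  (hP.not.or hP'.not).not.congr fun D u => by tauto

theorem false : EMLExpr fun (D : Database S) (_ : adom D) => False :=
  ⟨.ex 0 [.ne 0 0] 0 Fin.elim0 Fin.elim0, fun D u => by
    simp [EMLFormula.Sat, EMLLiteral.Sat]⟩

theorem const (p : Prop) : EMLExpr fun (D : Database S) (_ : adom D) => p := by
  by_cases hp : p
  · exact false.not.congr fun D u => by simp [hp]
  · exact false.congr fun D u => by simp [hp]

theorem exists_mem {J : Type} {s : Set J} (hs : s.Finite)
    {Q : J → (D : Database S) → adom D → Prop} (hQ : ∀ j ∈ s, EMLExpr (Q j)) :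
    EMLExpr fun D u => ∃ j ∈ s, Q j D u := by
  induction s, hs using Set.Finite.induction_on with
  | empty => exact false.congr fun D u => by simp
  | @insert j s _ _ ih =>
    exact ((hQ j (Set.mem_insert _ _)).or (ih fun j hj => hQ j (Set.mem_insert_of_mem _ hj))).congr
      fun D u => by simp

end EMLExpr

/-- The definability notion given by EML: maps with finitely many values, all of whose fibres are
expressed by formulas. -/
def emlDefinability (S : Schema) : Definability S where
  Def {α} g := (∃ s : Set α, s.Finite ∧ ∀ D u, g D u ∈ s) ∧ ∀ a, EMLExpr fun D u => g D u = a
  const a := ⟨⟨{a}, Set.finite_singleton a, fun _ _ => rfl⟩, fun b => .const (a = b)⟩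
  map := by
    rintro α β g f ⟨⟨s, hs, hg⟩, h⟩
    refine ⟨⟨f '' s, hs.image f, fun D u => Set.mem_image_of_mem f (hg D u)⟩, fun b => ?_⟩
    refine (EMLExpr.exists_mem (s := {a | a ∈ s ∧ f a = b}) (hs.subset fun a ha => ha.1)
      fun a _ => h a).congr fun D u => ⟨fun e => ⟨_, ⟨hg D u, e⟩, rfl⟩, ?_⟩
    rintro ⟨_, ⟨_, e⟩, rfl⟩
    exact e
  pair := by
    rintro α β g g' ⟨⟨s, hs, hg⟩, h⟩ ⟨⟨s', hs', hg'⟩, h'⟩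
    exact ⟨⟨s ×ˢ s', hs.prod hs', fun D u => ⟨hg D u, hg' D u⟩⟩, fun p =>
      ((h p.1).and (h' p.2)).congr fun D u => Prod.ext_iff⟩

theorem emlDefinability_prop_iff {S : Schema} {P : (D : Database S) → adom D → Prop} :
    (emlDefinability S).Def P ↔ EMLExpr P := by
  constructor
  · rintro ⟨-, h⟩
    exact (h True).congr fun D u => by simp
  · intro h
    refine ⟨⟨Set.univ, Set.toFinite _, fun _ _ => trivial⟩, fun a => ?_⟩
    by_cases ha : a
    · exact h.congr fun D u => by simp [ha]
    · exact h.not.congr fun D u => by simp [ha]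

/-- Distinct values of a pattern have distinct images, so its diagram needs only atoms, negated
atoms and inequalities, which are the literals that EML offers. -/
theorem EMLExpr.exists_emb {S : Schema} {J : Type} [Finite J] (F : Pattern S) (x : J → F.dom)
    {P : J → (D : Database S) → adom D → Prop} (hP : ∀ j, EMLExpr (P j)) :
    EMLExpr fun D u => ∃ h, IsEmb F D u h ∧ ∀ j, P j D (h (x j)) := by
  classical
  have := S.finite
  have := Fintype.ofFinite S.Rel
  choose φ hφ using hP
  let m := Nat.card F.dom
  let e : F.dom ≃ Fin m := Finite.equivFin _
  let e' := Finite.equivFin J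
  -- The point of the pattern becomes the free variable 0. One of the `m` bound variables is then
  -- left unconstrained, which does no harm.
  let σ : F.dom → Fin (m + 1) := fun i => if i = ⟨F.pt, F.pt_mem⟩ then 0 else (e i).succ
  let lits : List (EMLLiteral S (m + 1)) :=
    ((Finset.univ : Finset (Σ R : S.Rel, Fin (S.arity R) → F.dom)).toList.map fun p =>
      if (⟨p.1, fun i => (p.2 i : Value)⟩ : Fact S) ∈ F.db then .rel p.1 (σ ∘ p.2)
      else .notRel p.1 (σ ∘ p.2)) ++
    ((Finset.univ.filter fun p : F.dom × F.dom => p.1 ≠ p.2).toList.map fun p =>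
      .ne (σ p.1) (σ p.2))
  have hlits : ∀ (D : Database S) (v : Fin (m + 1) → adom D),
      (∀ l ∈ lits, l.Sat D v) ↔ IsEmb F D (v 0) (v ∘ σ) := by
    intro D v
    have h0 : σ ⟨F.pt, F.pt_mem⟩ = 0 := if_pos rfl
    have h1 : (∀ l ∈ lits, l.Sat D v) ↔
        (∀ (R : S.Rel) (t : Fin (S.arity R) → F.dom), (⟨R, fun i => (t i : Value)⟩ : Fact S) ∈ F.db ↔
          (⟨R, fun i => (v (σ (t i)) : Value)⟩ : Fact S) ∈ D) ∧
        ∀ i j : F.dom, i ≠ j → v (σ i) ≠ v (σ j) := by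
      simp only [lits, List.mem_append, or_imp, forall_and, List.forall_mem_map,
        Finset.mem_toList, Finset.mem_univ, true_imp_iff, Finset.mem_filter, true_and,
        Prod.forall, Sigma.forall]
      refine and_congr (forall₂_congr fun R t => ?_) Iff.rfl
      split_ifs with h <;> simp [EMLLiteral.Sat, h]
    rw [h1]
    constructor
    · rintro ⟨hr, hn⟩
      refine ⟨⟨congrArg v h0, fun R t => (hr R t).mp⟩, fun i j hij => ?_, fun R t => (hr R t).mpr⟩
      by_contra hne
      exact hn i j hne hij
    · rintro ⟨⟨-, hr⟩, hinj, hr'⟩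
      exact ⟨fun R t => ⟨hr R t, hr' R t⟩, fun i j hij => hinj.ne hij⟩
  refine ⟨.ex m lits (Nat.card J) (fun j => σ (x (e'.symm j))) fun j => φ (e'.symm j),
    fun D u => ?_⟩
  simp only [EMLFormula.Sat, hφ, hlits, Fin.cons_zero]
  constructor
  · rintro ⟨y, hy, hs⟩
    refine ⟨_, hy, fun j => ?_⟩
    have := hs (e' j)
    rwa [e'.symm_apply_apply] at this
  · rintro ⟨h, hh, hs⟩
    have hcomp : (Fin.cons u (h ∘ e.symm) : Fin (m + 1) → adom D) ∘ σ = h := by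
      funext i
      by_cases hi : i = ⟨F.pt, F.pt_mem⟩
      · subst hi
        simp [σ, hh.1.1]
      · simp [σ, hi]
    refine ⟨h ∘ e.symm, by rwa [hcomp], fun j => ?_⟩
    have := congrFun hcomp (x (e'.symm j))
    rw [Function.comp_apply] at this
    rw [this]
    exact hs _

/-- `Q` depends only on the atomic type of an assignment and on some EML-definable labelling. -/
def LocallyDetermined {S : Schema} {ι : Type}
    (Q : (D : Database S) → (ι → adom D) → Prop) : Prop :=
  ∃ (α : Type) (g : (D : Database S) → adom D → α), (emlDefinability S).Def g ∧
    ∀ (D D' : Database S) (h : ι → adom D) (h' : ι → adom D'),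
      atomicType D h = atomicType D' h' → (∀ i, g D (h i) = g D' (h' i)) → Q D h → Q D' h'

/-- `Q` is a union of classes given by an atomic type and a tuple of labels. Finitely many such
pairs are realised, and each amounts to an embedding of a pattern with EML conditions on the images.
-/
theorem LocallyDetermined.emlExpr_exists {S : Schema} {ι : Type} [Finite ι]
    {Q : (D : Database S) → (ι → adom D) → Prop} (hQ : LocallyDetermined Q) (i₀ : ι) :
    EMLExpr fun D u => ∃ h, h i₀ = u ∧ Q D h := by
  obtain ⟨α, g, ⟨⟨s, hs, hgs⟩, hg⟩, hQ⟩ := hQ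
  let J : Set (Set (Atom S ι) × (ι → α)) :=
    {p | ∃ (D : Database S) (h : ι → adom D), Q D h ∧ p = (atomicType D h, fun i => g D (h i))}
  have hJ : J.Finite := by
    refine (Set.finite_univ.prod (Set.Finite.pi' fun _ : ι => hs)).subset ?_
    rintro _ ⟨D, h, -, rfl⟩
    exact ⟨trivial, fun i => hgs D (h i)⟩
  refine (EMLExpr.exists_mem (Q := fun p D u => ∃ h : ι → adom D, h i₀ = u ∧
    atomicType D h = p.1 ∧ ∀ i, g D (h i) = p.2 i) hJ ?_).congr fun D u => ⟨?_, ?_⟩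
  · rintro _ ⟨D₀, h₀, -, rfl⟩
    obtain ⟨F, q, H⟩ := representable_atomicType i₀ D₀ h₀
    refine (EMLExpr.exists_emb F q fun i => hg (g D₀ (h₀ i))).congr fun D u => ⟨?_, ?_⟩
    · rintro ⟨h, hu, ht, hc⟩
      obtain ⟨h', hh', rfl⟩ := (H.iff D u h).mp ⟨hu, ht⟩
      exact ⟨h', hh', hc⟩
    · rintro ⟨h', hh', hc⟩
      obtain ⟨hu, ht⟩ := (H.iff D u (h' ∘ q)).mpr ⟨h', hh', rfl⟩
      exact ⟨_, hu, ht, hc⟩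
  · rintro ⟨h, hu, hh⟩
    exact ⟨_, ⟨D, h, hh, rfl⟩, h, hu, rfl, fun _ => rfl⟩
  · rintro ⟨_, ⟨D', h', hh', rfl⟩, h, hu, ht, hc⟩
    exact ⟨h, hu, hQ D' D h' h ht.symm (fun i => (hc i).symm) hh'⟩

namespace LocallyDetermined

variable {S : Schema} {ι κ : Type} {Q Q' : (D : Database S) → (ι → adom D) → Prop}

theorem congr (hQ : LocallyDetermined Q) (h : ∀ D v, Q' D v ↔ Q D v) : LocallyDetermined Q' := by
  obtain rfl : Q' = Q := funext₂ fun D v => propext (h D v)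
  exact hQ

theorem of_typeDetermined (hQ : TypeDetermined Q) : LocallyDetermined Q :=
  ⟨Unit, _, (emlDefinability S).const (), fun D D' h h' e _ => hQ D D' h h' e⟩

theorem atom (a : Atom S ι) : LocallyDetermined fun D h => a.Holds D h :=
  of_typeDetermined fun _ _ _ _ e => (holds_iff_of_atomicType_eq e a).mp

theorem label {α : Type} {g : (D : Database S) → adom D → α} (hg : (emlDefinability S).Def g)
    (i : ι) (a : α) : LocallyDetermined fun D (h : ι → adom D) => g D (h i) = a :=
  ⟨α, g, hg, fun _ _ _ _ _ e he => (e i).symm.trans he⟩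

theorem unary {P : (D : Database S) → adom D → Prop} (hP : EMLExpr P) (i : ι) :
    LocallyDetermined fun D (h : ι → adom D) => P D (h i) :=
  (label (emlDefinability_prop_iff.mpr hP) i True).congr fun D v => by simp

theorem not (hQ : LocallyDetermined Q) : LocallyDetermined fun D h => ¬ Q D h := by
  obtain ⟨α, g, hg, h⟩ := hQ
  exact ⟨α, g, hg, fun D D' v v' e e' hn hq => hn (h D' D v' v e.symm (fun i => (e' i).symm) hq)⟩

theorem and (hQ : LocallyDetermined Q) (hQ' : LocallyDetermined Q') :
    LocallyDetermined fun D h => Q D h ∧ Q' D h := by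
  obtain ⟨α, g, hg, h⟩ := hQ
  obtain ⟨α', g', hg', h'⟩ := hQ'
  refine ⟨_, _, (emlDefinability S).pair hg hg', fun D D' v v' e e' => And.imp ?_ ?_⟩
  · exact h D D' v v' e fun i => congrArg Prod.fst (e' i)
  · exact h' D D' v v' e fun i => congrArg Prod.snd (e' i)

theorem or (hQ : LocallyDetermined Q) (hQ' : LocallyDetermined Q') :
    LocallyDetermined fun D h => Q D h ∨ Q' D h :=
  (hQ.not.and hQ'.not).not.congr fun D v => by tauto

theorem comp (hQ : LocallyDetermined Q) (f : ι → κ) :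
    LocallyDetermined fun D (h : κ → adom D) => Q D (h ∘ f) := by
  obtain ⟨α, g, hg, h⟩ := hQ
  exact ⟨α, g, hg, fun D D' v v' e e' => h D D' _ _ (atomicType_comp f e) fun i => e' (f i)⟩

end LocallyDetermined

/-! ### Max-networks are captured by EML -/

/-- Max ignores multiplicities, so the result is a function of the set of label tuples `c` realised
by some mapping. Labels range over a finite set, so finitely many existential statements determine
it. -/
theorem emlDefinability_patternAgg_maxAgg {S : Schema} {α : Type} (k : MapKind) (F : Pattern S)
    (w : F.dom → α → ℝ) (g : (D : Database S) → adom D → α) (hg : (emlDefinability S).Def g) :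
    (emlDefinability S).Def (patternAgg k maxAgg F w g) := by
  classical
  obtain ⟨⟨s, hs, hgs⟩, -⟩ := id hg
  obtain ⟨Q, hQ, hQ'⟩ := typeDetermined_isMap k F
  have := hs.to_subtype
  have := Fintype.ofFinite (F.dom → s)
  have key : ∀ c : F.dom → s, EMLExpr fun D u =>
      ∃ h, k.IsMap F D u h ∧ ∀ i, g D (h i) = c i := by
    intro c
    have hloc : LocallyDetermined fun D h => Q D h ∧ ∀ i, g D (h i) = c i :=
      ⟨α, g, hg, fun D D' h h' e e' => And.imp (hQ D D' h h' e) fun H i => (e' i).symm.trans (H i)⟩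
    refine (hloc.emlExpr_exists ⟨F.pt, F.pt_mem⟩).congr fun D u => ?_
    simp only [hQ', and_assoc]
  have hdef := (emlDefinability S).pi fun c => emlDefinability_prop_iff.mpr (key c)
  have hmap := (emlDefinability S).map (fun t : (F.dom → s) → Prop =>
    ((Finset.univ.filter t).image fun c => ∏ x, w x (c x)).max.unbotD 0) hdef
  refine (congrArg (emlDefinability S).Def ?_).mpr hmap
  funext D u
  unfold patternAgg maxAgg
  congr 2
  ext r
  simp only [Multiset.mem_toFinset, Multiset.mem_map, Finset.mem_val, Finset.mem_filter,
    Finset.mem_univ, true_and, Finset.mem_image]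
  constructor
  · rintro ⟨h, hh, rfl⟩
    exact ⟨fun i => ⟨_, hgs D (h i)⟩, ⟨h, hh, fun _ => rfl⟩, rfl⟩
  · rintro ⟨c, ⟨h, hh, hc⟩, rfl⟩
    exact ⟨h, hh, by simp only [hc]⟩

theorem emlExpr_of_computable_maxAgg {S : Schema} {k : MapKind}
    {P : (D : Database S) → adom D → Prop} (hP : Computable k maxAgg P) : EMLExpr P := by
  obtain ⟨d, Ls, c, h⟩ := hP
  obtain rfl : P = fun D u => c (Ls.features k maxAgg D u) := funext₂ h
  exact emlDefinability_prop_iff.mp ((emlDefinability S).map c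
    ((emlDefinability S).features k maxAgg (emlDefinability_patternAgg_maxAgg k) Ls))

/-! ### EML is captured by embedding networks -/

/-- With weights 0 and 1 the product along a mapping is the indicator of the unary conditions, and
`ne_zero_iff` turns the aggregate into an existence test. There is one query for each realised type
satisfying `Q`. -/
theorem Computable.exists_typeDetermined {S : Schema} {ι : Type} [Finite ι] {agg : Aggregation}
    (ha : RegularAggregation agg) {Q : (D : Database S) → (ι → adom D) → Prop}
    (hQ : TypeDetermined Q) (i₀ : ι) {P : ι → (D : Database S) → adom D → Prop}
    (hP : ∀ i, Computable .emb agg (P i)) :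
    Computable .emb agg fun D u => ∃ h, h i₀ = u ∧ Q D h ∧ ∀ i, P i D (h i) := by
  classical
  have := Fintype.ofFinite ι
  let C := networkDefinability S .emb ha
  let w : ι → (ι → Prop) → ℝ := fun i p => if p i then 1 else 0
  let J := {τ : Set (Atom S ι) // ∃ D, ∃ h : ι → adom D, atomicType D h = τ ∧ Q D h}
  have hg : Computable .emb agg fun D u i => P i D u := C.pi hP
  have key : C.Def fun D u => ∃ τ : J, DeepNet.assignmentAgg agg
      (fun D h => atomicType D h = τ) i₀ w (fun D u i => P i D u) D u ≠ 0 := by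
    refine C.exists_index fun τ => C.map (fun r : ℝ => r ≠ 0) ?_
    obtain ⟨_, D, h, rfl, -⟩ := τ
    exact hg.assignmentAgg (representable_atomicType i₀ D h) w
  refine (congrArg (Computable .emb agg) ?_).mpr key
  have hw : ∀ (D : Database S) (h : ι → adom D),
      ∏ i, w i (fun i' => P i' D (h i)) = if ∀ i, P i D (h i) then 1 else 0 := by
    intro D h
    split_ifs with H
    · exact Finset.prod_eq_one fun i _ => if_pos (H i)
    · obtain ⟨i, hi⟩ := not_forall.mp H
      exact Finset.prod_eq_zero (Finset.mem_univ i) (if_neg hi)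
  funext D u
  refine propext (Iff.trans ?_ (exists_congr fun τ : J => Iff.symm (by
    unfold DeepNet.assignmentAgg
    simp only [hw]
    refine ha.ne_zero_iff _ fun x hx => ?_
    obtain ⟨h, -, rfl⟩ := Multiset.mem_map.mp hx
    split_ifs <;> simp)))
  simp only [Multiset.mem_map, Finset.mem_val, Finset.mem_filter, Finset.mem_univ, true_and]
  constructor
  · rintro ⟨h, hu, hq, hp⟩
    exact ⟨⟨_, D, h, rfl, hq⟩, h, ⟨hu, rfl⟩, if_pos hp⟩
  · rintro ⟨⟨_, D', h', rfl, hq⟩, h, ⟨hu, ht⟩, h1⟩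
    refine ⟨h, hu, hQ D' D h' h ht.symm hq, ?_⟩
    by_contra hne
    rw [if_neg hne] at h1
    exact zero_ne_one h1

theorem typeDetermined_literal {S : Schema} {n : ℕ} (l : EMLLiteral S n) :
    TypeDetermined fun D v => l.Sat D v := by
  intro D D' h h' e
  cases l with
  | rel R z => exact (holds_iff_of_atomicType_eq e (.rel R z)).mp
  | notRel R z => exact (not_congr (holds_iff_of_atomicType_eq e (.rel R z))).mp
  | ne i j => exact (not_congr (holds_iff_of_atomicType_eq e (.eq i j))).mp

theorem EMLFormula.computable {S : Schema} {agg : Aggregation} (ha : RegularAggregation agg)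
    (φ : EMLFormula S) : Computable .emb agg fun D u => φ.Sat D u := by
  let C := networkDefinability S .emb ha
  induction φ with
  | not φ ih => exact ih.map Not
  | or φ ψ ih₁ ih₂ => exact C.map₂ Or ih₁ ih₂
  | ex m lits p var sub ih =>
    have key := Computable.exists_typeDetermined ha
      (Q := fun D (v : Fin (m + 1) → adom D) => ∀ l ∈ lits, l.Sat D v)
      (fun D D' h h' e H l hl => typeDetermined_literal l D D' h h' e (H l hl)) 0
      -- Several subformulas may speak about the same variable, so variable `i` carries their
      -- conjunction.
      (P := fun i D u => ∀ j, var j = i → (sub j).Sat D u)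
      fun i => C.map (fun f : Fin p → Prop => ∀ j, var j = i → f j) (C.pi ih)
    refine (congrArg (Computable .emb agg) ?_).mpr key
    funext D u
    simp only [EMLFormula.Sat, eq_iff_iff]
    constructor
    · rintro ⟨y, hl, hs⟩
      exact ⟨_, rfl, hl, fun i j hj => hj ▸ hs j⟩
    · rintro ⟨h, rfl, hl, hs⟩
      refine ⟨Fin.tail h, ?_, ?_⟩ <;> rw [Fin.cons_self_tail]
      · exact hl
      · exact fun j => hs _ j rfl

theorem eml_expresses_iff {S : Schema} {P : ValueProperty S} :
    (EML S).Expresses P ↔ ∃ g : (D : Database S) → adom D → Prop, EMLExpr g ∧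
      ∀ X : PointedDatabase S, X ∈ P ↔ g X.db X.point := by
  constructor
  · rintro ⟨φ, h⟩
    exact ⟨_, ⟨φ, fun _ _ => Iff.rfl⟩, h⟩
  · rintro ⟨g, ⟨φ, hφ⟩, h⟩
    exact ⟨φ, fun X => (h X).trans (hφ _ _).symm⟩

theorem den_atLeastAsExpressive_eml {agg : Aggregation} (ha : RegularAggregation agg) :
    AtLeastAsExpressive (DEN agg) EML := by
  rintro S P ⟨φ, hφ⟩
  exact Computable.iff_expresses.mpr ⟨_, φ.computable ha, hφ⟩

theorem eml_atLeastAsExpressive_den_maxAgg : AtLeastAsExpressive EML (DEN maxAgg) := by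
  intro S P h
  obtain ⟨g, hg, hP⟩ := Computable.iff_expresses.mp h
  exact eml_expresses_iff.mpr ⟨g, emlExpr_of_computable_maxAgg hg, hP⟩

theorem eml_atLeastAsExpressive_dhn_maxAgg : AtLeastAsExpressive EML (DHN maxAgg) := by
  intro S P h
  obtain ⟨g, hg, hP⟩ := Computable.iff_expresses.mp h
  exact eml_expresses_iff.mpr ⟨g, emlExpr_of_computable_maxAgg hg, hP⟩


/-! ### UQAFO is captured by EML -/

/-- Relations of the form `∃ y, Q(v, y)` with `Q` locally determined. -/
def ExistentiallyDefined {S : Schema} {n : ℕ} (R : (D : Database S) → (Fin n → adom D) → Prop) :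
    Prop :=
  ∃ (κ : Type) (_ : Finite κ) (Q : (D : Database S) → (Fin n ⊕ κ → adom D) → Prop),
    LocallyDetermined Q ∧ ∀ D v, R D v ↔ ∃ y : κ → adom D, Q D (Sum.elim v y)

namespace ExistentiallyDefined

variable {S : Schema} {n : ℕ} {R R' : (D : Database S) → (Fin n → adom D) → Prop}

theorem congr (hR : ExistentiallyDefined R) (h : ∀ D v, R' D v ↔ R D v) :
    ExistentiallyDefined R' := by
  obtain rfl : R' = R := funext₂ fun D v => propext (h D v)
  exact hR

theorem of_locallyDetermined (hR : LocallyDetermined R) : ExistentiallyDefined R := by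
  refine ⟨Empty, inferInstance, _, hR.comp Sum.inl, fun D v => ?_⟩
  simp [Sum.elim_comp_inl]

theorem and (hR : ExistentiallyDefined R) (hR' : ExistentiallyDefined R') :
    ExistentiallyDefined fun D v => R D v ∧ R' D v := by
  obtain ⟨κ, _, Q, hQ, h⟩ := hR
  obtain ⟨κ', _, Q', hQ', h'⟩ := hR'
  refine ⟨κ ⊕ κ', inferInstance, _,
    (hQ.comp (Sum.map id Sum.inl)).and (hQ'.comp (Sum.map id Sum.inr)), fun D v => ?_⟩
  simp only [Sum.elim_comp_map, Function.comp_id, h, h']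
  constructor
  · rintro ⟨⟨y, hy⟩, y', hy'⟩
    exact ⟨Sum.elim y y', by simpa using hy, by simpa using hy'⟩
  · rintro ⟨y, hy, hy'⟩
    exact ⟨⟨_, hy⟩, _, hy'⟩

/-- The witnesses of the disjunct that is not used still need values, and the active domain could be
empty; a free variable supplies one. -/
theorem or (hn : 0 < n) (hR : ExistentiallyDefined R) (hR' : ExistentiallyDefined R') :
    ExistentiallyDefined fun D v => R D v ∨ R' D v := by
  obtain ⟨κ, _, Q, hQ, h⟩ := hR
  obtain ⟨κ', _, Q', hQ', h'⟩ := hR'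
  refine ⟨κ ⊕ κ', inferInstance, _,
    (hQ.comp (Sum.map id Sum.inl)).or (hQ'.comp (Sum.map id Sum.inr)), fun D v => ?_⟩
  simp only [Sum.elim_comp_map, Function.comp_id, h, h']
  constructor
  · rintro (⟨y, hy⟩ | ⟨y', hy'⟩)
    · exact ⟨Sum.elim y fun _ => v ⟨0, hn⟩, .inl (by simpa using hy)⟩
    · exact ⟨Sum.elim (fun _ => v ⟨0, hn⟩) y', .inr (by simpa using hy')⟩
  · rintro ⟨y, hy | hy⟩
    · exact .inl ⟨_, hy⟩
    · exact .inr ⟨_, hy⟩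

theorem ex {R : (D : Database S) → (Fin (n + 1) → adom D) → Prop} (hR : ExistentiallyDefined R) :
    ExistentiallyDefined fun D v => ∃ a, R D (Fin.cons a v : Fin (n + 1) → adom D) := by
  obtain ⟨κ, _, Q, hQ, h⟩ := hR
  let f : Fin (n + 1) ⊕ κ → Fin n ⊕ (κ ⊕ Unit) :=
    Sum.elim (Fin.cons (.inr (.inr ())) Sum.inl : Fin (n + 1) → Fin n ⊕ (κ ⊕ Unit))
      (Sum.inr ∘ Sum.inl)
  have hf : ∀ (D : Database S) (v : Fin n → adom D) (y : κ ⊕ Unit → adom D),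
      Sum.elim v y ∘ f = Sum.elim (Fin.cons (y (.inr ())) v : Fin (n + 1) → adom D)
        (y ∘ Sum.inl) := by
    intro D v y
    funext i
    rcases i with i | i
    · refine Fin.cases ?_ (fun i => ?_) i <;> simp [f]
    · simp [f]
  refine ⟨κ ⊕ Unit, inferInstance, _, hQ.comp f, fun D v => ?_⟩
  simp only [hf, h]
  constructor
  · rintro ⟨a, y, hy⟩
    exact ⟨Sum.elim y fun _ => a, by simpa using hy⟩
  · rintro ⟨y, hy⟩
    exact ⟨_, _, hy⟩

theorem emlExpr {R : (D : Database S) → (Fin 1 → adom D) → Prop} (hR : ExistentiallyDefined R) :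
    EMLExpr fun D u => R D fun _ => u := by
  obtain ⟨κ, _, Q, hQ, h⟩ := hR
  refine (hQ.emlExpr_exists (.inl 0)).congr fun D u => ?_
  rw [h]
  constructor
  · rintro ⟨y, hy⟩
    exact ⟨_, rfl, hy⟩
  · rintro ⟨v, rfl, hv⟩
    refine ⟨v ∘ Sum.inr, ?_⟩
    convert hv
    funext i
    rcases i with i | i
    · simp [Subsingleton.elim i 0]
    · rfl

end ExistentiallyDefined

/-- Universal formulas are treated through their negations. At an alternation the subformula has one
free variable, so by induction it is EML-definable and can be absorbed into the labelling of the
kernel instead of adding a quantifier. -/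
theorem KindFormula.existentiallyDefined {S : Schema} {k : QKind} {n : ℕ} (φ : KindFormula S k n)
    (hn : 0 < n) :
    match k with
    | .ex => ExistentiallyDefined fun D v => φ.Sat D v
    | .all => ExistentiallyDefined fun D v => ¬ φ.Sat D v := by
  induction φ with
  | @rel k n R z =>
    have h := LocallyDetermined.atom (Atom.rel R z)
    cases k
    · exact .of_locallyDetermined h
    · exact .of_locallyDetermined h.not
  | @notRel k n R z =>
    have h := (LocallyDetermined.atom (Atom.rel R z)).not
    cases k
    · exact .of_locallyDetermined h
    · exact .of_locallyDetermined h.not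
  | @eq k n i j =>
    have h := LocallyDetermined.atom (S := S) (Atom.eq i j)
    cases k
    · exact .of_locallyDetermined h
    · exact .of_locallyDetermined h.not
  | @ne k n i j =>
    have h := (LocallyDetermined.atom (S := S) (Atom.eq i j)).not
    cases k
    · exact .of_locallyDetermined h
    · exact .of_locallyDetermined h.not
  | @and k n φ ψ ih₁ ih₂ =>
    cases k
    · exact (ih₁ hn).and (ih₂ hn)
    · exact ((ih₁ hn).or hn (ih₂ hn)).congr fun D v => not_and_or
  | @or k n φ ψ ih₁ ih₂ =>
    cases k
    · exact (ih₁ hn).or hn (ih₂ hn)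
    · exact ((ih₁ hn).and (ih₂ hn)).congr fun D v => not_or
  | ex φ ih => exact (ih (Nat.succ_pos _)).ex
  | all φ ih => exact (ih (Nat.succ_pos _)).ex.congr fun D v => not_forall
  | altAll i φ ih =>
    refine .of_locallyDetermined ((LocallyDetermined.unary (ih one_pos).emlExpr i).not.congr ?_)
    exact fun D v => not_not.symm
  | altEx i φ ih =>
    exact .of_locallyDetermined (LocallyDetermined.unary (ih one_pos).emlExpr i).not

theorem UQAFOFormula.emlExpr {S : Schema} (φ : UQAFOFormula S 1) :
    EMLExpr fun D u => φ.Sat D fun _ => u := by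
  induction φ with
  | @ofKind k φ =>
    have h := φ.existentiallyDefined one_pos
    cases k
    · exact ExistentiallyDefined.emlExpr h
    · exact (ExistentiallyDefined.emlExpr h).not.congr fun D u => not_not.symm
  | and φ ψ ih₁ ih₂ => exact ih₁.and ih₂
  | or φ ψ ih₁ ih₂ => exact ih₁.or ih₂

/-! ### EML is captured by UQAFO -/

/-- Relations defined by a formula of the given kind. -/
def KindDefined {S : Schema} (k : QKind) {n : ℕ}
    (R : (D : Database S) → (Fin n → adom D) → Prop) : Prop :=
  ∃ φ : KindFormula S k n, ∀ D v, φ.Sat D v ↔ R D v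

namespace KindDefined

variable {S : Schema} {n : ℕ} {R R' : (D : Database S) → (Fin n → adom D) → Prop}

theorem congr {k : QKind} (hR : KindDefined k R) (h : ∀ D v, R' D v ↔ R D v) :
    KindDefined k R' := by
  obtain rfl : R' = R := funext₂ fun D v => propext (h D v)
  exact hR

theorem and {k : QKind} (hR : KindDefined k R) (hR' : KindDefined k R') :
    KindDefined k fun D v => R D v ∧ R' D v := by
  obtain ⟨φ, hφ⟩ := hR
  obtain ⟨φ', hφ'⟩ := hR'
  exact ⟨.and φ φ', fun D v => and_congr (hφ D v) (hφ' D v)⟩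

theorem or {k : QKind} (hR : KindDefined k R) (hR' : KindDefined k R') :
    KindDefined k fun D v => R D v ∨ R' D v := by
  obtain ⟨φ, hφ⟩ := hR
  obtain ⟨φ', hφ'⟩ := hR'
  exact ⟨.or φ φ', fun D v => or_congr (hφ D v) (hφ' D v)⟩

theorem true {k : QKind} (hn : 0 < n) :
    KindDefined k fun (D : Database S) (_ : Fin n → adom D) => True :=
  ⟨.eq ⟨0, hn⟩ ⟨0, hn⟩, fun D v => by simp [KindFormula.Sat]⟩

theorem literal {k : QKind} {m : ℕ} (l : EMLLiteral S m) (ρ : Fin m → Fin n) :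
    KindDefined k fun D (v : Fin n → adom D) => l.Sat D (v ∘ ρ) := by
  cases l with
  | rel R z => exact ⟨.rel R (ρ ∘ z), fun _ _ => Iff.rfl⟩
  | notRel R z => exact ⟨.notRel R (ρ ∘ z), fun _ _ => Iff.rfl⟩
  | ne i j => exact ⟨.ne (ρ i) (ρ j), fun _ _ => Iff.rfl⟩

theorem forall_mem {k : QKind} (hn : 0 < n) {J : Type} (l : List J)
    {R : J → (D : Database S) → (Fin n → adom D) → Prop} (hR : ∀ j ∈ l, KindDefined k (R j)) :
    KindDefined k fun D v => ∀ j ∈ l, R j D v := by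
  induction l with
  | nil => exact (true hn).congr fun D v => by simp
  | cons j l ih =>
    exact ((hR j List.mem_cons_self).and (ih fun j hj => hR j (List.mem_cons_of_mem _ hj))).congr
      fun D v => List.forall_mem_cons

theorem ex {R : (D : Database S) → (Fin (n + 1) → adom D) → Prop} (hR : KindDefined .ex R) :
    KindDefined .ex fun D v => ∃ a, R D (Fin.cons a v : Fin (n + 1) → adom D) := by
  obtain ⟨φ, hφ⟩ := hR
  exact ⟨.ex φ, fun D v => exists_congr fun a => hφ D _⟩

/-- Each quantifier shifts the context by one, so the matrix is required under every renaming of its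
variables into a nonempty context. The induction moves the first bound variable into position 0 of
the free block and quantifies it last. -/
theorem ex_many : ∀ {m n : ℕ} {R : (D : Database S) → (Fin n → adom D) → (Fin m → adom D) → Prop},
    (∀ (N : ℕ) (_ : 0 < N) (ρ : Fin n → Fin N) (σ : Fin m → Fin N),
      KindDefined .ex fun D v => R D (v ∘ ρ) (v ∘ σ)) → 0 < n →
    KindDefined .ex fun D v => ∃ y, R D v y
  | 0, n, R, h, hn => by
    refine (h n hn id Fin.elim0).congr fun D v => ⟨?_, fun H => ⟨_, H⟩⟩
    rintro ⟨y, hy⟩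
    rwa [Subsingleton.elim (v ∘ Fin.elim0) y]
  | m + 1, n, R, h, hn => by
    have key := ex_many (m := m) (n := n + 1)
      (R := fun D v y => R D (v ∘ Fin.succ) (Fin.cons (v 0) y : Fin (m + 1) → adom D)) ?_
      (Nat.succ_pos n)
    · refine key.ex.congr fun D v => ?_
      have hv : ∀ a, (Fin.cons a v : Fin (n + 1) → adom D) ∘ Fin.succ = v := fun a => rfl
      simp only [hv, Fin.cons_zero]
      constructor
      · rintro ⟨y, hy⟩
        exact ⟨y 0, Fin.tail y, by rwa [Fin.cons_self_tail]⟩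
      · rintro ⟨a, y, hy⟩
        exact ⟨_, hy⟩
    · intro N hN ρ σ
      refine (h N hN (ρ ∘ Fin.succ) (Fin.cons (ρ 0) σ : Fin (m + 1) → Fin N)).congr fun D v => ?_
      have : (Fin.cons ((v ∘ ρ) 0) (v ∘ σ) : Fin (m + 1) → adom D) =
          v ∘ (Fin.cons (ρ 0) σ : Fin (m + 1) → Fin N) := by
        funext i
        refine Fin.cases ?_ (fun i => ?_) i <;> simp
      rw [this]
      rfl

theorem altAll {P : (D : Database S) → adom D → Prop}
    (hP : KindDefined .all fun D (v : Fin 1 → adom D) => P D (v 0)) (i : Fin n) :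
    KindDefined .ex fun D v => P D (v i) := by
  obtain ⟨φ, hφ⟩ := hP
  exact ⟨.altAll i φ, fun D v => hφ D _⟩

theorem altEx {P : (D : Database S) → adom D → Prop}
    (hP : KindDefined .ex fun D (v : Fin 1 → adom D) => P D (v 0)) (i : Fin n) :
    KindDefined .all fun D v => P D (v i) := by
  obtain ⟨φ, hφ⟩ := hP
  exact ⟨.altEx i φ, fun D v => hφ D _⟩

end KindDefined

/-- Pushing negation to the literals dualises every connective and quantifier, which exchanges the
two kinds. -/
theorem KindFormula.exists_neg {S : Schema} {k : QKind} {n : ℕ} (φ : KindFormula S k n) :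
    match k with
    | .ex => KindDefined .all fun D v => ¬ φ.Sat D v
    | .all => KindDefined .ex fun D v => ¬ φ.Sat D v := by
  induction φ with
  | @rel k n R z => cases k <;> exact ⟨.notRel R z, fun _ _ => Iff.rfl⟩
  | @notRel k n R z => cases k <;> exact ⟨.rel R z, fun _ _ => not_not.symm⟩
  | @eq k n i j => cases k <;> exact ⟨.ne i j, fun _ _ => Iff.rfl⟩
  | @ne k n i j => cases k <;> exact ⟨.eq i j, fun _ _ => not_not.symm⟩
  | @and k n φ ψ ih₁ ih₂ => cases k <;> exact (ih₁.or ih₂).congr fun D v => not_and_or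
  | @or k n φ ψ ih₁ ih₂ => cases k <;> exact (ih₁.and ih₂).congr fun D v => not_or
  | ex φ ih =>
    obtain ⟨ψ, hψ⟩ := ih
    exact ⟨.all ψ, fun D v => (forall_congr' fun a => hψ D _).trans not_exists.symm⟩
  | all φ ih =>
    obtain ⟨ψ, hψ⟩ := ih
    exact ⟨.ex ψ, fun D v => (exists_congr fun a => hψ D _).trans not_forall.symm⟩
  | altAll i φ ih =>
    obtain ⟨ψ, hψ⟩ := ih
    exact ⟨.altEx i ψ, fun D v => hψ D _⟩
  | altEx i φ ih =>
    obtain ⟨ψ, hψ⟩ := ih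
    exact ⟨.altAll i ψ, fun D v => hψ D _⟩

/-- The existential kind is kept as the invariant. A negation leads to the universal kind, and since
only one variable is free, `altAll` leads back. -/
theorem EMLFormula.kindDefined {S : Schema} (φ : EMLFormula S) :
    KindDefined .ex fun D (v : Fin 1 → adom D) => φ.Sat D (v 0) := by
  induction φ with
  | not φ ih =>
    obtain ⟨ψ, hψ⟩ := ih
    exact (KindDefined.altAll (P := fun D u => ¬ φ.Sat D u)
      (KindDefined.congr ψ.exists_neg fun D v => not_congr (hψ D v).symm) 0)
  | or φ ψ ih₁ ih₂ => exact ih₁.or ih₂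
  | ex m lits p var sub ih =>
    refine KindDefined.congr (KindDefined.ex_many (m := m) (n := 1)
      (R := fun D v y => (∀ l ∈ lits, l.Sat D (Fin.cons (v 0) y : Fin (m + 1) → adom D)) ∧
        ∀ j : Fin p, (sub j).Sat D ((Fin.cons (v 0) y : Fin (m + 1) → adom D) (var j))) ?_ one_pos)
      fun D v => Iff.rfl
    intro N hN ρ σ
    have hcomp : ∀ (D : Database S) (v : Fin N → adom D),
        (Fin.cons ((v ∘ ρ) 0) (v ∘ σ) : Fin (m + 1) → adom D) =
          v ∘ (Fin.cons (ρ 0) σ : Fin (m + 1) → Fin N) := by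
      intro D v
      funext i
      refine Fin.cases ?_ (fun i => ?_) i <;> simp
    simp only [hcomp]
    refine KindDefined.and (KindDefined.forall_mem hN _ fun l _ => .literal l _) ?_
    refine (KindDefined.forall_mem hN (List.finRange p) (R := fun j D v => (sub j).Sat D
      ((v ∘ (Fin.cons (ρ 0) σ : Fin (m + 1) → Fin N)) (var j))) fun j _ => ?_).congr
      fun D v => by simp
    -- Alternating twice has no effect on the meaning; it serves to substitute the variable `var j`
    -- of the larger context for the single free variable.
    exact KindDefined.altAll (P := fun D u => (sub j).Sat D u)
      (KindDefined.altEx (P := fun D u => (sub j).Sat D u) (ih j) 0) _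

theorem sameExpressivePower_uqafo_eml : SameExpressivePower UQAFO EML := by
  constructor
  · rintro S P ⟨φ, hφ⟩
    obtain ⟨ψ, hψ⟩ := φ.kindDefined
    exact ⟨.ofKind ψ, fun X => (hφ X).trans (hψ X.db fun _ => X.point).symm⟩
  · rintro S P ⟨φ, hφ⟩
    exact eml_expresses_iff.mpr ⟨_, φ.emlExpr, hφ⟩


/-! ### Local transitivity -/

theorem comp_vec_two {α β : Type} (f : α → β) (a b : α) :
    (fun i : Fin 2 => f (![a, b] i)) = ![f a, f b] := by
  funext i
  fin_cases i <;> rfl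

theorem eml_expresses_locallyTransitive : (EML graphSchema).Expresses LocallyTransitive := by
  have hQ : LocallyDetermined (S := graphSchema) fun D (h : Fin 3 → adom D) =>
      (Atom.rel (S := graphSchema) () ![0, 1]).Holds D h ∧
        (Atom.rel (S := graphSchema) () ![1, 2]).Holds D h ∧
          ¬ (Atom.rel (S := graphSchema) () ![0, 2]).Holds D h :=
    (LocallyDetermined.atom _).and ((LocallyDetermined.atom _).and (LocallyDetermined.atom _).not)
  have hE : ∀ (D : Database graphSchema) (h : Fin 3 → adom D) (i j : Fin 3),
      (Atom.rel (S := graphSchema) () ![i, j]).Holds D h ↔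
        (⟨(), ![(h i : Value), (h j : Value)]⟩ : Fact graphSchema) ∈ D := by
    intro D h i j
    rw [← comp_vec_two (fun x => (h x : Value)) i j]
    rfl
  refine eml_expresses_iff.mpr ⟨_, (hQ.emlExpr_exists 0).not, fun X => ?_⟩
  simp only [hE]
  constructor
  · rintro hX ⟨h, h0, h1, h2, h3⟩
    refine h3 ?_
    rw [h0] at h1 ⊢
    exact hX _ _ h1 h2
  · intro hX u₁ u₂ h1 h2
    by_contra h3
    -- EML quantifies over the active domain only, but the edge from `u₁` to `u₂` places both values
    -- there.
    have m1 : u₁ ∈ adom X.db := mem_adom.mpr ⟨_, h2, 0, rfl⟩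
    have m2 : u₂ ∈ adom X.db := mem_adom.mpr ⟨_, h2, 1, rfl⟩
    exact hX ⟨![X.point, ⟨u₁, m1⟩, ⟨u₂, m2⟩], rfl, h1, h2, h3⟩

theorem maxAgg_eq_of_forall_eq {M : Multiset ℝ} {c : ℝ} (hM : M ≠ 0) (h : ∀ x ∈ M, x = c) :
    maxAgg M = c := by
  obtain ⟨a, ha⟩ := Multiset.exists_mem_of_ne_zero hM
  obtain rfl := h a ha
  have : M.toFinset = {a} := by
    ext x
    simp only [Multiset.mem_toFinset, Finset.mem_singleton]
    exact ⟨h x, fun e => e ▸ ha⟩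
  simp [maxAgg, this]

/-- Homomorphism max-networks do not distinguish values of reflexive graphs. -/
theorem features_hom_maxAgg_eq {d : ℕ} (Ls : LayerSeq graphSchema d) (D D' : Database graphSchema)
    (hD : ∀ a ∈ adom D, (⟨(), fun _ => a⟩ : Fact graphSchema) ∈ D)
    (hD' : ∀ a ∈ adom D', (⟨(), fun _ => a⟩ : Fact graphSchema) ∈ D') (u : adom D)
    (u' : adom D') : Ls.features .hom maxAgg D u = Ls.features .hom maxAgg D' u' := by
  induction Ls generalizing D D' with
  | nil => rfl
  | snoc Ls L ih =>
    have key : ∀ (D : Database graphSchema)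
        (_ : ∀ a ∈ adom D, (⟨(), fun _ => a⟩ : Fact graphSchema) ∈ D) (u : adom D) j i,
        (L.query j).eval .hom maxAgg D (LayerSeq.features .hom maxAgg D Ls) u i =
          ∏ x, (L.query j).trans x (LayerSeq.features .hom maxAgg D Ls u) i := by
      intro D hD u j i
      classical
      -- Loops make the constant map to `u` a homomorphism, so the maximum is not over an empty
      -- multiset. By induction all values carry the same label, so all products coincide.
      refine maxAgg_eq_of_forall_eq (fun h0 => ?_) fun x hx => ?_
      · rw [Multiset.map_eq_zero] at h0
        have hmem : (fun _ => u) ∈ (Finset.univ.filter fun h : (L.query j).pattern.dom → adom D =>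
            MapKind.hom.IsMap (L.query j).pattern D u h) := by
          rw [Finset.mem_filter]
          exact ⟨Finset.mem_univ _, rfl, fun R t _ => hD u u.2⟩
        rw [Finset.val_eq_zero.mp h0] at hmem
        exact Finset.notMem_empty _ hmem
      · obtain ⟨h, -, rfl⟩ := Multiset.mem_map.mp hx
        exact Finset.prod_congr rfl fun y _ => by rw [ih D D hD hD (h y) u]
    simp only [LayerSeq.features, Layer.apply]
    congr 1
    funext j i
    rw [key D hD, key D' hD', ih D D' hD hD' u u']

theorem not_dhn_maxAgg_expresses_locallyTransitive :
    ¬ (DHN maxAgg graphSchema).Expresses LocallyTransitive := by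
  classical
  rintro ⟨N, hN⟩
  let e : ℕ → ℕ → Fact graphSchema := fun a b => ⟨(), ![a, b]⟩
  have he : ∀ a b a' b', e a b = e a' b' ↔ a = a' ∧ b = b' := by
    intro a b a' b'
    simp only [e, Fact.mk.injEq, heq_eq_eq, true_and]
    exact ⟨fun h => ⟨congrFun h 0, congrFun h 1⟩, fun h => by rw [h.1, h.2]⟩
  have hloop : ∀ a, (⟨(), fun _ => a⟩ : Fact graphSchema) = e a a := by
    intro a
    simp only [e, Fact.mk.injEq, heq_eq_eq, true_and]
    funext i
    exact (Fin.forall_fin_two (p := fun i => a = ![a, a] i)).mpr ⟨rfl, rfl⟩ i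
  have hargs : ∀ a b (i : Fin 2), (e a b).args i = a ∨ (e a b).args i = b := fun a b i =>
    (Fin.forall_fin_two (p := fun i => (e a b).args i = a ∨ (e a b).args i = b)).mpr
      ⟨.inl rfl, .inr rfl⟩ i
  -- A single loop against a reflexive path 0, 1, 2 without the edge from 0 to 2. Both graphs are
  -- reflexive, and only the first is locally transitive at 0.
  let D : Database graphSchema := {e 0 0}
  let D' : Database graphSchema := {e 0 0, e 1 1, e 2 2, e 0 1, e 1 2}
  have hD : ∀ a ∈ adom D, (⟨(), fun _ => a⟩ : Fact graphSchema) ∈ D := by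
    intro a ha
    obtain ⟨f, hf, i, rfl⟩ := mem_adom.mp ha
    obtain rfl := Finset.mem_singleton.mp hf
    have : (e 0 0).args i = 0 := or_self_iff.mp (hargs 0 0 i)
    rw [hloop, this]
    exact Finset.mem_singleton_self _
  have hD' : ∀ a ∈ adom D', (⟨(), fun _ => a⟩ : Fact graphSchema) ∈ D' := by
    intro a ha
    obtain ⟨f, hf, i, rfl⟩ := mem_adom.mp ha
    rw [hloop]
    have hle : f.args i = 0 ∨ f.args i = 1 ∨ f.args i = 2 := by
      simp only [D', Finset.mem_insert, Finset.mem_singleton] at hf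
      rcases hf with rfl | rfl | rfl | rfl | rfl
      · have := hargs 0 0 i; tauto
      · have := hargs 1 1 i; tauto
      · have := hargs 2 2 i; tauto
      · have := hargs 0 1 i; tauto
      · have := hargs 1 2 i; tauto
    rcases hle with h | h | h <;> rw [h] <;> simp [D']
  let X : PointedDatabase graphSchema :=
    ⟨D, 0, mem_adom.mpr ⟨e 0 0, Finset.mem_singleton_self _, (0 : Fin 2), rfl⟩⟩
  let X' : PointedDatabase graphSchema :=
    ⟨D', 0, mem_adom.mpr ⟨e 0 0, Finset.mem_insert_self _ _, (0 : Fin 2), rfl⟩⟩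
  have hX : X ∈ LocallyTransitive := by
    intro u₁ u₂ h1 h2
    obtain ⟨-, h⟩ := (he _ _ _ _).mp (Finset.mem_singleton.mp h2)
    obtain rfl : u₂ = 0 := h
    exact Finset.mem_singleton_self _
  have hX' : X' ∉ LocallyTransitive := by
    intro h
    have h02 : e 0 2 ∈ D' := h 1 2 (by simp [X', D', e]) (by simp [X', D', e])
    simp [D', he] at h02
  refine hX' ((hN X').mpr ?_)
  have := (hN X).mp hX
  change N.cls _ = true at this ⊢
  rwa [features_hom_maxAgg_eq N.layers D' D hD' hD X'.point X.point]


/-! ### PQR-orders -/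

/-- The edge relation of a database. -/
def Edge (D : Database pqrSchema) (a b : Value) : Prop :=
  (⟨.E, ![a, b]⟩ : Fact pqrSchema) ∈ D

/-- The number of out-neighbours. -/
noncomputable def outDegree (D : Database pqrSchema) (a : Value) : ℕ := {b | Edge D a b}.ncard

/-- The labels of `a` agree with its out-degree modulo `3`. -/
def DegreeLabelled (D : Database pqrSchema) (a : Value) : Prop :=
  ((⟨.P, ![a]⟩ : Fact pqrSchema) ∈ D ↔ outDegree D a % 3 = 0) ∧
  ((⟨.Q, ![a]⟩ : Fact pqrSchema) ∈ D ↔ outDegree D a % 3 = 2) ∧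
  ((⟨.R, ![a]⟩ : Fact pqrSchema) ∈ D ↔ outDegree D a % 3 = 1)

theorem Edge.mem_adom {D : Database pqrSchema} {a b : Value} (h : Edge D a b) :
    a ∈ adom D ∧ b ∈ adom D :=
  ⟨DeepNet.mem_adom.mpr ⟨_, h, (0 : Fin 2), rfl⟩, DeepNet.mem_adom.mpr ⟨_, h, (1 : Fin 2), rfl⟩⟩

theorem outDegree_eq_of_enumeration {D : Database pqrSchema} {n : ℕ} {f : Fin (n + 1) → Value}
    (hinj : Function.Injective f) (hclosed : ∀ i b, Edge D (f i) b → b ∈ Set.range f)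
    (hE : ∀ i j, Edge D (f i) (f j) ↔ i ≤ j) (i : Fin (n + 1)) :
    outDegree D (f i) = n + 1 - i := by
  have : {b | Edge D (f i) b} = f '' (Finset.Ici i : Finset (Fin (n + 1))) := by
    ext b
    simp only [Set.mem_ofPred_eq, Finset.coe_Ici, Set.mem_image, Set.mem_Ici]
    constructor
    · intro h
      obtain ⟨j, rfl⟩ := hclosed i b h
      exact ⟨j, (hE i j).mp h, rfl⟩
    · rintro ⟨j, hj, rfl⟩
      exact (hE i j).mpr hj
  rw [outDegree, this, Set.ncard_image_of_injective _ hinj, Set.ncard_coe_finset, Fin.card_Ici]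

/-- The out-neighbours of `v` are linearly ordered by the edge relation, with minimum `v`. -/
structure OrderedNeighbours (D : Database pqrSchema) (v : Value) : Prop where
  refl : Edge D v v
  total : ∀ a b, Edge D v a → Edge D v b → Edge D a b ∨ Edge D b a
  antisymm : ∀ a b, Edge D v a → Edge D v b → Edge D a b → Edge D b a → a = b
  trans : ∀ a b c, Edge D v a → Edge D a b → Edge D b c → Edge D a c

theorem OrderedNeighbours.exists_enumeration {D : Database pqrSchema} {v : Value}
    (H : OrderedNeighbours D v) :
    ∃ (n : ℕ) (f : Fin (n + 1) → Value), f 0 = v ∧ Function.Injective f ∧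
      (∀ u, u ∈ Set.range f ↔ Edge D v u) ∧ ∀ i j, Edge D (f i) (f j) ↔ i ≤ j := by
  classical
  -- An opaque copy of the out-neighbours, so that the order defined by edges does not clash with
  -- the one inherited from ℕ.
  obtain ⟨V, ⟨q⟩⟩ : ∃ V : Type, Nonempty (V ≃ {u // Edge D v u}) := ⟨_, ⟨Equiv.refl _⟩⟩
  let _ : LinearOrder V :=
    { le := fun a b => Edge D (q a) (q b)
      le_refl := fun a => (H.total _ _ (q a).2 (q a).2).elim id id
      le_trans := fun a b c => H.trans _ _ _ (q a).2
      le_antisymm := fun a b h h' =>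
        q.injective (Subtype.ext (H.antisymm _ _ (q a).2 (q b).2 h h'))
      le_total := fun a b => H.total _ _ (q a).2 (q b).2
      toDecidableLE := fun _ _ => Classical.propDecidable _ }
  have hfin : Finite {u // Edge D v u} :=
    Set.Finite.subset (adom D).finite_toSet fun u (hu : Edge D v u) => hu.mem_adom.2
  have := Finite.of_equiv _ q.symm
  have := Fintype.ofFinite V
  have : Nonempty V := ⟨q.symm ⟨v, H.refl⟩⟩
  obtain ⟨n, hn⟩ := Nat.exists_eq_succ_of_ne_zero (Fintype.card_pos (α := V)).ne'
  let e : Fin (n + 1) ≃o V := Fintype.orderIsoFinOfCardEq V hn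
  have hE : ∀ i j, Edge D (q (e i)) (q (e j)) ↔ i ≤ j := fun i j => e.map_rel_iff
  refine ⟨n, fun i => q (e i), ?_,
    Subtype.val_injective.comp (q.injective.comp e.injective), fun u => ⟨?_, fun hu => ?_⟩, hE⟩
  · refine H.antisymm _ _ (q (e 0)).2 H.refl ?_ (q (e 0)).2
    have := (hE 0 (e.symm (q.symm ⟨v, H.refl⟩))).mpr (Fin.zero_le _)
    rwa [e.apply_symm_apply, q.apply_symm_apply] at this
  · rintro ⟨i, rfl⟩
    exact (q (e i)).2
  · exact ⟨e.symm (q.symm ⟨u, hu⟩), by simp⟩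

/-- Transitivity makes the reachable vertices the out-neighbours of the point, so all conditions
become local. The `i`-th vertex has out-degree `n + 1 - i` with `n + 1` divisible by 3, so the
residues 0, 1, 2 of `i` appear as out-degree residues 0, 2, 1. -/
theorem mem_pqrOrder_iff {X : PointedDatabase pqrSchema} :
    X ∈ PQROrder ↔ OrderedNeighbours X.db X.pt ∧ outDegree X.db X.pt % 3 = 0 ∧
      ∀ u, Edge X.db X.pt u → DegreeLabelled X.db u := by
  constructor
  · rintro ⟨n, f, hn, h0, hinj, hreach, hE, hlab⟩
    change ∀ u, _ ↔ Relation.ReflTransGen (Edge X.db) X.pt u at hreach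
    change ∀ i j, Edge X.db (f i) (f j) ↔ i ≤ j at hE
    have hrange : ∀ u, Edge X.db X.pt u ↔ u ∈ Set.range f := by
      intro u
      refine ⟨fun h => (hreach u).mpr (.single h), ?_⟩
      rintro ⟨i, rfl⟩
      rw [← h0]
      exact (hE 0 i).mpr (Fin.zero_le _)
    have hclosed : ∀ i b, Edge X.db (f i) b → b ∈ Set.range f := fun i b h =>
      (hreach b).mpr (((hreach (f i)).mp ⟨i, rfl⟩).tail h)
    have hdeg := outDegree_eq_of_enumeration hinj hclosed hE
    refine ⟨⟨?_, ?_, ?_, ?_⟩, ?_, ?_⟩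
    · exact (hrange _).mpr ⟨0, h0⟩
    · simp only [hrange]
      rintro _ _ ⟨i, rfl⟩ ⟨j, rfl⟩
      simp only [hE]
      exact le_total i j
    · simp only [hrange]
      rintro _ _ ⟨i, rfl⟩ ⟨j, rfl⟩
      simp only [hE]
      exact fun h h' => congrArg f (le_antisymm h h')
    · simp only [hrange]
      rintro _ b c ⟨i, rfl⟩ hab hbc
      obtain ⟨j, rfl⟩ := hclosed i b hab
      obtain ⟨k, rfl⟩ := hclosed j c hbc
      rw [hE] at *
      exact hab.trans hbc
    · rw [← h0, hdeg]
      simp only [Fin.val_zero]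
      omega
    · simp only [hrange]
      rintro _ ⟨i, rfl⟩
      obtain ⟨h1, h2, h3⟩ := hlab i
      have hi := i.2
      refine ⟨h1.trans ?_, h2.trans ?_, h3.trans ?_⟩ <;> rw [hdeg] <;> omega
  · rintro ⟨H, h3, hlab⟩
    obtain ⟨n, f, h0, hinj, hrange, hE⟩ := H.exists_enumeration
    have hclosed : ∀ i b, Edge X.db (f i) b → b ∈ Set.range f := fun i b h => by
      have hi := (hrange (f i)).mp ⟨i, rfl⟩
      exact (hrange b).mpr (H.trans _ _ _ H.refl hi h)
    have hdeg := outDegree_eq_of_enumeration hinj hclosed hE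
    rw [← h0, hdeg] at h3
    simp only [Fin.val_zero] at h3
    refine ⟨n, f, by omega, h0, hinj, fun u => ?_, hE, fun i => ?_⟩
    · change _ ↔ Relation.ReflTransGen (Edge X.db) X.pt u
      refine ⟨fun hu => .single ((hrange u).mp hu), fun hu => ?_⟩
      induction hu with
      | refl => exact ⟨0, h0⟩
      | tail _ h ih =>
        obtain ⟨i, rfl⟩ := ih
        exact hclosed i _ h
    · obtain ⟨h1, h2, h3⟩ := hlab (f i) ((hrange _).mp ⟨i, rfl⟩)
      have hi := i.2
      rw [hdeg] at h1 h2 h3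
      refine ⟨h1.trans ?_, h2.trans ?_, h3.trans ?_⟩ <;> omega

/-! ### Sum-networks express PQR-order -/

theorem holds_edge_iff {ι : Type} {D : Database pqrSchema} {h : ι → adom D} {i j : ι} :
    (Atom.rel (S := pqrSchema) .E ![i, j]).Holds D h ↔ Edge D (h i) (h j) := by
  rw [Edge, ← comp_vec_two (fun x => (h x : Value)) i j]
  rfl

theorem computable_outDegree :
    Computable .emb sumAgg fun (D : Database pqrSchema) (u : adom D) => outDegree D u := by
  classical
  have key := (Computable.sum_emb (S := pqrSchema) (ι := Fin 2)
    ((networkDefinability pqrSchema .emb regularAggregation_sumAgg).const ())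
    (Q := fun D h => (Atom.rel (S := pqrSchema) .E ![0, 1]).Holds D h)
    (fun D D' h h' e => (holds_iff_of_atomicType_eq e _).mp) 0 (fun _ _ => 1)).map
      -- With all weights 1 the sum counts the out-edges as a real number; the floor turns it back
      -- into a natural number.
      fun r => ⌊r⌋₊
  refine (congrArg (Computable .emb sumAgg) ?_).mpr key
  funext D u
  let T : Finset (adom D) := Finset.univ.filter fun b => Edge D u b
  have hinj : Function.Injective fun b : adom D => (![u, b] : Fin 2 → adom D) :=
    fun a b h => congrFun h 1
  rw [assignmentAgg_eq (s := T.map ⟨_, hinj⟩)]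
  · have : {b | Edge D u b} = (T.map ⟨_, Subtype.val_injective⟩ : Finset Value) := by
      ext b
      simp only [Set.mem_ofPred_eq, Finset.coe_map, Function.Embedding.coeFn_mk, Set.mem_image,
        Finset.mem_coe, T, Finset.mem_filter, Finset.mem_univ, true_and]
      exact ⟨fun h => ⟨⟨b, h.mem_adom.2⟩, h, rfl⟩, by rintro ⟨b, h, rfl⟩; exact h⟩
    rw [outDegree, this, Set.ncard_coe_finset, Finset.card_map]
    simp [sumAgg]
  · intro h
    simp only [holds_edge_iff, Finset.mem_map, Function.Embedding.coeFn_mk, T, Finset.mem_filter,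
      Finset.mem_univ, true_and]
    constructor
    · rintro ⟨b, hb, rfl⟩
      exact ⟨rfl, hb⟩
    · rintro ⟨rfl, hb⟩
      refine ⟨h 1, hb, ?_⟩
      funext i
      fin_cases i <;> rfl

theorem computable_degreeLabelled :
    Computable .emb sumAgg fun (D : Database pqrSchema) (u : adom D) => DegreeLabelled D u := by
  let C := networkDefinability pqrSchema .emb regularAggregation_sumAgg
  have hmem : ∀ (s : PQRSymbol) (z : Fin (pqrSchema.arity s) → Fin 1),
      C.Def fun D u => (⟨s, fun i => ((fun _ : Fin 1 => u) (z i) : Value)⟩ : Fact pqrSchema) ∈ D := by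
    intro s z
    have := Computable.exists_typeDetermined (S := pqrSchema) regularAggregation_sumAgg
      (Q := fun D h => (Atom.rel (S := pqrSchema) s z).Holds D h)
      (fun D D' h h' e => (holds_iff_of_atomicType_eq e _).mp) (0 : Fin 1)
      (fun _ => C.const True)
    refine (congrArg (Computable .emb sumAgg) ?_).mpr this
    funext D u
    refine propext ⟨fun h => ⟨fun _ => u, rfl, h, fun _ => trivial⟩, ?_⟩
    rintro ⟨h, rfl, hh, -⟩
    have : h = fun _ => h 0 := funext fun i => congrArg h (Subsingleton.elim _ _)
    rw [this] at hh
    exact hh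
  have hvec : ∀ a : Value, (fun _ : Fin 1 => a) = ![a] := fun a => by
    funext i
    simp
  have hP := hmem .P fun _ => 0
  have hQ := hmem .Q fun _ => 0
  have hR := hmem .R fun _ => 0
  refine (congrArg (Computable .emb sumAgg) ?_).mpr
    (C.map (fun p : (Prop × Prop × Prop) × ℕ => (p.1.1 ↔ p.2 % 3 = 0) ∧ (p.1.2.1 ↔ p.2 % 3 = 2) ∧
      (p.1.2.2 ↔ p.2 % 3 = 1)) (C.pair (C.pair hP (C.pair hQ hR)) computable_outDegree))
  funext D u
  simp only [DegreeLabelled, ← hvec]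

/-- Each disjunct is a counterexample to one field. Four variables are enough for all of them, so
the order conditions become the negation of one existential statement with a type-determined kernel.
-/
theorem OrderedNeighbours.iff_not_exists {D : Database pqrSchema} {v : adom D} :
    OrderedNeighbours D v ↔ ¬ ∃ h : Fin 4 → adom D, h 0 = v ∧ (¬ Edge D (h 0) (h 0) ∨
      (Edge D (h 0) (h 1) ∧ Edge D (h 0) (h 2) ∧ ¬ Edge D (h 1) (h 2) ∧ ¬ Edge D (h 2) (h 1)) ∨
      (Edge D (h 0) (h 1) ∧ Edge D (h 0) (h 2) ∧ Edge D (h 1) (h 2) ∧ Edge D (h 2) (h 1) ∧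
        ¬ h 1 = h 2) ∨
      (Edge D (h 0) (h 1) ∧ Edge D (h 1) (h 2) ∧ Edge D (h 2) (h 3) ∧ ¬ Edge D (h 1) (h 3))) := by
  constructor
  · rintro H ⟨h, rfl, h1 | ⟨h1, h2, h3, h4⟩ | ⟨h1, h2, h3, h4, h5⟩ | ⟨h1, h2, h3, h4⟩⟩
    · exact h1 H.refl
    · exact (H.total _ _ h1 h2).elim h3 h4
    · exact h5 (Subtype.ext (H.antisymm _ _ h1 h2 h3 h4))
    · exact h4 (H.trans _ _ _ h1 h2 h3)
  · intro H
    have H' : ∀ a b c : adom D, _ := fun a b c => not_exists.mp H ![v, a, b, c]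
    simp only [Matrix.cons_val, true_and, not_or] at H'
    refine ⟨?_, fun a b ha hb => ?_, fun a b ha hb hab hba => ?_, fun a b c ha hab hbc => ?_⟩
    · exact not_not.mp (H' v v v).1
    · have := (H' ⟨a, ha.mem_adom.2⟩ ⟨b, hb.mem_adom.2⟩ v).2.1
      by_contra hne
      exact this ⟨ha, hb, fun h => hne (.inl h), fun h => hne (.inr h)⟩
    · have := (H' ⟨a, ha.mem_adom.2⟩ ⟨b, hb.mem_adom.2⟩ v).2.2.1
      by_contra hne
      exact this ⟨ha, hb, hab, hba, fun h => hne (congrArg Subtype.val h)⟩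
    · have := (H' ⟨a, ha.mem_adom.2⟩ ⟨b, hab.mem_adom.2⟩ ⟨c, hbc.mem_adom.2⟩).2.2.2
      by_contra hne
      exact this ⟨ha, hab, hbc, hne⟩

theorem den_sumAgg_expresses_pqrOrder : (DEN sumAgg pqrSchema).Expresses PQROrder := by
  let C := networkDefinability pqrSchema .emb regularAggregation_sumAgg
  have hedge : ∀ (D D' : Database pqrSchema) (h : Fin 4 → adom D) (h' : Fin 4 → adom D'),
      atomicType D h = atomicType D' h' → ∀ i j, Edge D (h i) (h j) ↔ Edge D' (h' i) (h' j) :=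
    fun D D' h h' e i j => holds_edge_iff.symm.trans
      ((holds_iff_of_atomicType_eq e _).trans holds_edge_iff)
  have hord : C.Def fun D u => OrderedNeighbours D u := by
    have key := Computable.exists_typeDetermined (S := pqrSchema) regularAggregation_sumAgg
      (Q := fun D (h : Fin 4 → adom D) => ¬ Edge D (h 0) (h 0) ∨
      (Edge D (h 0) (h 1) ∧ Edge D (h 0) (h 2) ∧ ¬ Edge D (h 1) (h 2) ∧ ¬ Edge D (h 2) (h 1)) ∨
      (Edge D (h 0) (h 1) ∧ Edge D (h 0) (h 2) ∧ Edge D (h 1) (h 2) ∧ Edge D (h 2) (h 1) ∧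
        ¬ h 1 = h 2) ∨
      (Edge D (h 0) (h 1) ∧ Edge D (h 1) (h 2) ∧ Edge D (h 2) (h 3) ∧ ¬ Edge D (h 1) (h 3)))
      (fun D D' h h' e => by
        have heq : h 1 = h 2 ↔ h' 1 = h' 2 := holds_iff_of_atomicType_eq e (.eq 1 2)
        simp only [hedge D D' h h' e, heq]
        exact id) 0 (fun _ => C.const True)
    refine (congrArg (Computable .emb sumAgg) ?_).mpr (key.map Not)
    funext D u
    simp only [OrderedNeighbours.iff_not_exists, implies_true, and_true]
  have hlab : C.Def fun D u => ∀ b, Edge D u b → DegreeLabelled D b := by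
    have key := Computable.exists_typeDetermined (S := pqrSchema) regularAggregation_sumAgg
      (Q := fun D h => (Atom.rel (S := pqrSchema) .E ![0, 1]).Holds D h)
      (fun D D' h h' e => (holds_iff_of_atomicType_eq e _).mp) (0 : Fin 2)
      (P := fun i D u => i = 1 → ¬ DegreeLabelled D u)
      (fun i => C.map (fun p : Prop => i = 1 → ¬ p) computable_degreeLabelled)
    refine (congrArg (Computable .emb sumAgg) ?_).mpr (key.map Not)
    funext D u
    simp only [holds_edge_iff, eq_iff_iff]
    constructor
    · rintro H ⟨h, rfl, he, hl⟩
      exact hl 1 rfl (H _ he)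
    · intro H b hb
      by_contra hne
      exact H ⟨![u, ⟨b, hb.mem_adom.2⟩], rfl, hb, by rintro _ rfl; exact hne⟩
  refine Computable.iff_expresses.mpr ⟨_, C.map₂ And hord (C.map₂ And
    (C.map (fun d : ℕ => d % 3 = 0) computable_outDegree) hlab), fun X => mem_pqrOrder_iff⟩


/-! ### EML does not express PQR-orders -/

/-- The atomic facts about positions of a word with letters `c`. -/
def wordHolds (c : ℕ → ℕ) : (s : PQRSymbol) → (Fin (pqrSchema.arity s) → ℕ) → Prop
  | .E, t => t 0 ≤ t 1
  | .P, t => c (t 0) = 0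
  | .Q, t => c (t 0) = 1
  | .R, t => c (t 0) = 2

theorem finite_wordFacts (N : ℕ) (c : ℕ → ℕ) :
    {f : Fact pqrSchema | (∀ i, f.args i < N) ∧ wordHolds c f.rel f.args}.Finite := by
  have : Set.Finite (Set.range fun p : Σ s : PQRSymbol, Fin (pqrSchema.arity s) → Fin N =>
      (⟨p.1, fun i => (p.2 i : ℕ)⟩ : Fact pqrSchema)) := Set.finite_range _
  refine this.subset ?_
  rintro ⟨s, t⟩ ⟨ht, -⟩
  exact ⟨⟨s, fun i => ⟨t i, ht i⟩⟩, rfl⟩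

/-- The reflexive linear order on `0, …, N - 1` with labels given by `c`. -/
noncomputable def wordDatabase (N : ℕ) (c : ℕ → ℕ) : Database pqrSchema :=
  (finite_wordFacts N c).toFinset

theorem mem_wordDatabase {N : ℕ} {c : ℕ → ℕ} {s : PQRSymbol} {t : Fin (pqrSchema.arity s) → ℕ} :
    (⟨s, t⟩ : Fact pqrSchema) ∈ wordDatabase N c ↔ (∀ i, t i < N) ∧ wordHolds c s t :=
  Set.Finite.mem_toFinset _

theorem edge_wordDatabase {N : ℕ} {c : ℕ → ℕ} {a b : ℕ} :
    Edge (wordDatabase N c) a b ↔ a ≤ b ∧ b < N := by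
  refine mem_wordDatabase.trans ?_
  have : (∀ i : Fin 2, (![a, b] : Fin 2 → ℕ) i < N) ↔ a < N ∧ b < N := Fin.forall_fin_two
  refine (and_congr_left' this).trans ?_
  change (a < N ∧ b < N) ∧ a ≤ b ↔ _
  omega

theorem unary_wordDatabase {N : ℕ} {c : ℕ → ℕ} {a : ℕ} (ha : a < N) :
    ((⟨.P, ![a]⟩ : Fact pqrSchema) ∈ wordDatabase N c ↔ c a = 0) ∧
    ((⟨.Q, ![a]⟩ : Fact pqrSchema) ∈ wordDatabase N c ↔ c a = 1) ∧
    ((⟨.R, ![a]⟩ : Fact pqrSchema) ∈ wordDatabase N c ↔ c a = 2) := by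
  have : ∀ i : Fin 1, (![a] : Fin 1 → ℕ) i < N := fun i => by simpa using ha
  exact ⟨mem_wordDatabase.trans (and_iff_right this), mem_wordDatabase.trans (and_iff_right this),
    mem_wordDatabase.trans (and_iff_right this)⟩

theorem mem_adom_wordDatabase {N : ℕ} {c : ℕ → ℕ} {a : ℕ} :
    a ∈ adom (wordDatabase N c) ↔ a < N := by
  constructor
  · intro h
    obtain ⟨⟨s, t⟩, hf, i, rfl⟩ := mem_adom.mp h
    exact (mem_wordDatabase.mp hf).1 i
  · exact fun h => (edge_wordDatabase.mpr ⟨le_rfl, h⟩ : Edge _ a a).mem_adom.1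

theorem atomicType_wordDatabase_eq {ι : Type} {N : ℕ} {c c' : ℕ → ℕ}
    {v : ι → adom (wordDatabase N c)} {v' : ι → adom (wordDatabase N c')}
    (hle : ∀ i j, (v i : ℕ) ≤ v j ↔ (v' i : ℕ) ≤ v' j) (hc : ∀ i, c (v i) = c' (v' i)) :
    atomicType _ v = atomicType _ v' := by
  ext a
  cases a with
  | rel s z =>
    refine mem_wordDatabase.trans (Iff.trans ?_ mem_wordDatabase.symm)
    refine and_congr (iff_of_true (fun i => mem_adom_wordDatabase.mp (v (z i)).2)
      fun i => mem_adom_wordDatabase.mp (v' (z i)).2) ?_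
    cases s with
    | E => exact hle _ _
    | P => exact iff_of_eq (congrArg (· = 0) (hc _))
    | Q => exact iff_of_eq (congrArg (· = 1) (hc _))
    | R => exact iff_of_eq (congrArg (· = 2) (hc _))
  | eq i j =>
    change v i = v j ↔ v' i = v' j
    rw [Subtype.ext_iff, Subtype.ext_iff, le_antisymm_iff, le_antisymm_iff, hle, hle]

/-- Words of length `N` whose letters follow the pattern `0, 1, 2, 0, 1, 2, …`, except possibly
at position `p`. -/
structure AlmostCyclic (N p : ℕ) (c : ℕ → ℕ) : Prop where
  dvd : N % 3 = 0
  lt : c p < 3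
  eq : ∀ i, i ≠ p → c i = i % 3

/-- Positions that are equal and at distance less than `t` from one of the ends, or have the same
letter and are both further away from the ends. -/
def SimilarPositions (N t : ℕ) (c c' : ℕ → ℕ) (x x' : ℕ) : Prop :=
  (x = x' ∧ (x < t ∨ N ≤ x + t)) ∨
    (t ≤ x ∧ x + t < N ∧ t ≤ x' ∧ x' + t < N ∧ c x = c' x')

theorem SimilarPositions.symm {N t : ℕ} {c c' : ℕ → ℕ} {x x' : ℕ}
    (h : SimilarPositions N t c c' x x') : SimilarPositions N t c' c x' x := by
  rcases h with ⟨rfl, h⟩ | ⟨h1, h2, h3, h4, h5⟩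
  · exact .inl ⟨rfl, h⟩
  · exact .inr ⟨h3, h4, h1, h2, h5.symm⟩

/-- One round of the game. Each of the at most `m + 1` chosen positions may need a block of three
consecutive positions of its own, in which every letter occurs; hence each round costs a margin of
`3 * m + 3` at either end. The exceptional position `p` lies outside these margins, so the blocks
are cyclic in both words. -/
theorem exists_similar_embedding {N p m t : ℕ} {c c' : ℕ → ℕ} (hc : AlmostCyclic N p c)
    (hc' : AlmostCyclic N p c') (ht : t % 3 = 0) (hp : t + (3 * m + 3) ≤ p)
    (hp' : p + (t + (3 * m + 3)) < N) {x x' : ℕ} (hx' : x' < N)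
    (hxx : SimilarPositions N (t + (3 * m + 3)) c c' x x') (Y : Finset ℕ) (hY : Y.card ≤ m + 1)
    (hYN : ∀ y ∈ Y, y < N) :
    ∃ f : ℕ → ℕ, f x = x' ∧ StrictMonoOn f Y ∧
      ∀ y ∈ Y, f y < N ∧ c y = c' (f y) ∧ SimilarPositions N t c c' y (f y) := by
  classical
  -- The rank of `y` in `Y` selects its block, which keeps the order.
  let b : ℕ → ℕ := fun y => (Y.filter (· < y)).card
  have hbm : ∀ y ∈ Y, b y ≤ m := by
    intro y hy
    have : (Y.filter (· < y)).card < Y.card :=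
      Finset.card_lt_card (Finset.filter_ssubset.mpr ⟨y, hy, lt_irrefl y⟩)
    exact Nat.lt_succ_iff.mp (this.trans_le hY)
  have hbmono : ∀ y ∈ Y, ∀ z, y < z → b y + 1 ≤ b z := by
    intro y hy z hyz
    refine Finset.card_lt_card (Finset.ssubset_iff_of_subset ?_ |>.mpr ⟨y, ?_, ?_⟩)
    · exact Finset.monotone_filter_right _ fun a _ ha => lt_trans ha hyz
    · exact Finset.mem_filter.mpr ⟨hy, hyz⟩
    · simp
  have hc3 : ∀ y, c y < 3 := fun y => by
    by_cases h : y = p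
    · exact h ▸ hc.lt
    · rw [hc.eq y h]; omega
  -- Positions within `t` of an end stay fixed. Others below `x` move to blocks just inside the left
  -- zone, and others above `x` to blocks just inside the right zone, with their letter as offset.
  -- If `x` is itself in the margin on that side then `x' = x`, and they need not move.
  let f : ℕ → ℕ := fun y =>
    if y = x then x' else if y < t ∨ N ≤ y + t then y else
      if y < x then (if x < t + (3 * m + 3) then y else t + 3 * b y + c y)
      else (if N ≤ x + (t + (3 * m + 3)) then y else N - t - (3 * m + 3) + 3 * b y + c y)
  have hN := hc.dvd
  refine ⟨f, if_pos rfl, ?_, ?_⟩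
  · intro y hy z hz hyz
    have h1 := hbm y hy
    have h2 := hbm z hz
    have h3 := hbmono y hy z hyz
    have h4 := hc3 y
    have h5 := hc3 z
    have h6 := hYN y hy
    have h7 := hYN z hz
    simp only [f]
    generalize b y = by' at *
    generalize b z = bz at *
    unfold SimilarPositions at hxx
    generalize c x = cx at *
    generalize c' x' = cx' at *
    generalize c y = cy at *
    generalize c z = cz at *
    split_ifs <;> omega
  · intro y hy
    have h1 := hbm y hy
    have h4 := hc3 y
    have h6 := hYN y hy
    have hid : y ≠ p → c y = c' y := fun h => (hc.eq y h).trans (hc'.eq y h).symm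
    simp only [f]
    split_ifs with k1 k2 k3 k4 k5
    · subst k1
      rcases hxx with ⟨rfl, h⟩ | ⟨g1, g2, g3, g4, g5⟩
      · have e := hid (by omega)
        refine ⟨hx', e, ?_⟩
        by_cases hz : y < t ∨ N ≤ y + t
        · exact .inl ⟨rfl, hz⟩
        · exact .inr ⟨by omega, by omega, by omega, by omega, e⟩
      · exact ⟨hx', g5, .inr ⟨by omega, by omega, by omega, by omega, g5⟩⟩
    · exact ⟨h6, hid (by omega), .inl ⟨rfl, k2⟩⟩
    · have e := hid (by omega)
      exact ⟨h6, e, .inr ⟨by omega, by omega, by omega, by omega, e⟩⟩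
    -- As `t` is a multiple of 3, the residue of this position is the letter `c y`.
    · have e : c y = c' (t + 3 * b y + c y) := by
        rw [hc'.eq _ (by omega)]
        omega
      exact ⟨by omega, e, .inr ⟨by omega, by omega, by omega, by omega, e⟩⟩
    · have e := hid (by omega)
      exact ⟨h6, e, .inr ⟨by omega, by omega, by omega, by omega, e⟩⟩
    · have e : c y = c' (N - t - (3 * m + 3) + 3 * b y + c y) := by
        rw [hc'.eq _ (by omega)]
        omega
      exact ⟨by omega, e, .inr ⟨by omega, by omega, by omega, by omega, e⟩⟩

/-- `φ` does not distinguish similar positions of almost cyclic words, when `m` and `r` bound its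
numbers of variables and its quantifier depth. -/
def InvariantAt (φ : EMLFormula pqrSchema) (m r : ℕ) : Prop :=
  ∀ (N p : ℕ) (c c' : ℕ → ℕ), AlmostCyclic N p c → AlmostCyclic N p c' →
    (3 * m + 3) * r ≤ p → p + (3 * m + 3) * r < N →
    ∀ (x : adom (wordDatabase N c)) (x' : adom (wordDatabase N c')),
      SimilarPositions N ((3 * m + 3) * r) c c' x x' → φ.Sat _ x → φ.Sat _ x'

/-- The free variable and the witnesses give at most `m + 1` positions. Their images have the same
atomic type, which settles the literals, and remain similar for the smaller margin, which settles
the subformulas. -/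
theorem InvariantAt.ex {k p : ℕ} {lits : List (EMLLiteral pqrSchema (k + 1))}
    {var : Fin p → Fin (k + 1)} {sub : Fin p → EMLFormula pqrSchema} {m r : ℕ} (hk : k ≤ m)
    (hsub : ∀ j, InvariantAt (sub j) m r) : InvariantAt (.ex k lits p var sub) m (r + 1) := by
  classical
  intro N q c c' hc hc' hq hq' x x' hxx
  rw [Nat.mul_add, Nat.mul_one] at hq hq' hxx
  rintro ⟨y, hl, hs⟩
  set v : Fin (k + 1) → adom (wordDatabase N c) := Fin.cons x y with hv
  have ht : (3 * m + 3) * r % 3 = 0 := by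
    rw [← Nat.mul_add_one, Nat.mul_assoc, Nat.mul_mod_right]
  obtain ⟨f, hfx, hmono, hf⟩ := exists_similar_embedding hc hc' ht hq hq'
    (mem_adom_wordDatabase.mp x'.2) hxx (Finset.univ.image fun i => (v i : ℕ))
    (Finset.card_image_le.trans (by simpa using hk)) (by
      intro a ha
      obtain ⟨i, -, rfl⟩ := Finset.mem_image.mp ha
      exact mem_adom_wordDatabase.mp (v i).2)
  have hmem : ∀ i, (v i : ℕ) ∈ Finset.univ.image fun i => (v i : ℕ) := fun i =>
    Finset.mem_image_of_mem _ (Finset.mem_univ i)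
  let v' : Fin (k + 1) → adom (wordDatabase N c') := fun i =>
    ⟨f (v i), mem_adom_wordDatabase.mpr (hf _ (hmem i)).1⟩
  have hv' : (Fin.cons x' (Fin.tail v') : Fin (k + 1) → adom (wordDatabase N c')) = v' := by
    have : v' 0 = x' := Subtype.ext hfx
    rw [← this, Fin.cons_self_tail]
  have htype : atomicType _ v = atomicType _ v' := atomicType_wordDatabase_eq
    (fun i j => (hmono.le_iff_le (hmem i) (hmem j)).symm) fun i => (hf _ (hmem i)).2.1
  refine ⟨Fin.tail v', ?_⟩
  rw [hv']
  exact ⟨fun l hl' => typeDetermined_literal l _ _ _ _ htype (hl l hl'), fun j =>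
    hsub j N q c c' hc hc' (by omega) (by omega) _ _ (hf _ (hmem _)).2.2 (hs j)⟩

/-- Invariance is claimed for all large `m` and `r`, so that different subformulas can share one
pair of bounds. Negation works because similarity is symmetric and the two words play symmetric
roles. -/
theorem EMLFormula.exists_invariantAt (φ : EMLFormula pqrSchema) :
    ∃ m₀ r₀, ∀ m, m₀ ≤ m → ∀ r, r₀ ≤ r → InvariantAt φ m r := by
  induction φ with
  | not φ ih =>
    obtain ⟨m₀, r₀, h⟩ := ih
    exact ⟨m₀, r₀, fun m hm r hr N p c c' hc hc' hp hp' x x' hxx hφ hφ' =>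
      hφ (h m hm r hr N p c' c hc' hc hp hp' x' x hxx.symm hφ')⟩
  | or φ ψ ih₁ ih₂ =>
    obtain ⟨m₁, r₁, h₁⟩ := ih₁
    obtain ⟨m₂, r₂, h₂⟩ := ih₂
    refine ⟨max m₁ m₂, max r₁ r₂, fun m hm r hr N p c c' hc hc' hp hp' x x' hxx => Or.imp ?_ ?_⟩
    · exact h₁ m (le_of_max_le_left hm) r (le_of_max_le_left hr) N p c c' hc hc' hp hp' x x' hxx
    · exact h₂ m (le_of_max_le_right hm) r (le_of_max_le_right hr) N p c c' hc hc' hp hp' x x' hxx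
  | ex k lits p var sub ih =>
    choose m₀ r₀ h using ih
    refine ⟨max k (Finset.univ.sup m₀), Finset.univ.sup r₀ + 1, fun m hm r hr => ?_⟩
    obtain ⟨s, rfl⟩ := Nat.exists_eq_add_of_le' hr
    rw [← add_assoc]
    exact InvariantAt.ex (le_of_max_le_left hm) fun j => h j m
      ((Finset.le_sup (Finset.mem_univ j)).trans (le_of_max_le_right hm)) _
      ((Finset.le_sup (Finset.mem_univ j)).trans (Nat.le_add_left _ _))

theorem wordDatabase_orderedNeighbours {N : ℕ} (hN : 0 < N) (c : ℕ → ℕ) :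
    OrderedNeighbours (wordDatabase N c) 0 := by
  constructor <;> simp only [edge_wordDatabase]
  · omega
  · intro (a : ℕ) (b : ℕ)
    omega
  · intro (a : ℕ) (b : ℕ) _ _ h h'
    exact le_antisymm h.1 h'.1
  · intro (a : ℕ) (b : ℕ) (d : ℕ)
    omega

theorem outDegree_wordDatabase {N : ℕ} {c : ℕ → ℕ} (a : ℕ) :
    outDegree (wordDatabase N c) a = N - a := by
  have : {b | Edge (wordDatabase N c) a b} = (Finset.Ico a N : Finset ℕ) := by
    ext b
    simp [edge_wordDatabase]
  rw [outDegree, this, Set.ncard_coe_finset, Nat.card_Ico]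

theorem not_eml_expresses_pqrOrder : ¬ (EML pqrSchema).Expresses PQROrder := by
  rintro ⟨φ, hφ⟩
  obtain ⟨m, r, h⟩ := φ.exists_invariantAt
  -- Using `r + 1` makes `t` positive, so that the point 0 lies in the left end zone and is similar
  -- to itself.
  let t := (3 * m + 3) * (r + 1)
  have ht : t % 3 = 0 := by
    simp only [t]
    rw [← Nat.mul_add_one, Nat.mul_assoc, Nat.mul_mod_right]
  have hpos : 0 < t := by positivity
  -- A multiple of 3 that leaves more than `t` positions on the right of the altered position `t`.
  let N := 2 * t + 3
  let c : ℕ → ℕ := fun i => i % 3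
  -- The letter at `t` should be 0, because 3 divides `t`.
  let c' : ℕ → ℕ := fun i => if i = t then 1 else i % 3
  have hN : 0 < N := Nat.succ_pos _
  let X : PointedDatabase pqrSchema := ⟨wordDatabase N c, 0, mem_adom_wordDatabase.mpr hN⟩
  let X' : PointedDatabase pqrSchema := ⟨wordDatabase N c', 0, mem_adom_wordDatabase.mpr hN⟩
  have hlab : ∀ u : ℕ, u < N → DegreeLabelled (wordDatabase N c) u := by
    intro u hu
    obtain ⟨h1, h2, h3⟩ := unary_wordDatabase (c := c) hu
    refine ⟨h1.trans ?_, h2.trans ?_, h3.trans ?_⟩ <;> rw [outDegree_wordDatabase] <;>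
      simp only [c] <;> omega
  have hX : X ∈ PQROrder := by
    refine mem_pqrOrder_iff.mpr ⟨wordDatabase_orderedNeighbours hN c, ?_, fun u hu => ?_⟩
    · change outDegree (wordDatabase N c) 0 % 3 = 0
      rw [outDegree_wordDatabase]
      omega
    · exact hlab u (edge_wordDatabase.mp hu).2
  have hX' : X' ∉ PQROrder := by
    intro hX'
    have htN : t < N := by omega
    have := ((mem_pqrOrder_iff.mp hX').2.2 t (edge_wordDatabase.mpr ⟨Nat.zero_le _, htN⟩)).1
    change (_ ∈ wordDatabase N c' ↔ outDegree (wordDatabase N c') t % 3 = 0) at this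
    rw [(unary_wordDatabase htN).1, outDegree_wordDatabase] at this
    have h0 : c' t = 0 := this.mpr (by omega)
    simp [c'] at h0
  refine hX' ((hφ X').mpr (h m le_rfl (r + 1) (Nat.le_succ r) N t c c' ?_ ?_ le_rfl ?_ X.point
    X'.point (.inl ⟨rfl, .inl hpos⟩) ((hφ X).mp hX)))
  · exact ⟨by omega, Nat.mod_lt _ (by norm_num), fun i _ => rfl⟩
  · exact ⟨by omega, by simp [c'], fun i hi => if_neg hi⟩
  · change t + t < N
    omega

end DeepNet

theorem theorem4 :
    -- (1) UQAFO, EML and max-DENs have the same expressive power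
    (SameExpressivePower UQAFO EML ∧ SameExpressivePower EML (DEN maxAgg) ∧
      SameExpressivePower UQAFO (DEN maxAgg)) ∧
    -- (2) sum-DENs are strictly more expressive than UQAFO, separated by PQR-order
    (StrictlyMoreExpressive (DEN sumAgg) UQAFO ∧
      (DEN sumAgg pqrSchema).Expresses PQROrder ∧
      ¬ (UQAFO pqrSchema).Expresses PQROrder) ∧
    -- (3) sum-DENs and sum-DHNs have the same expressive power
    SameExpressivePower (DEN sumAgg) (DHN sumAgg) ∧
    -- (4) max-DENs are strictly more expressive than max-DHNs, separated by local transitivity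
    (StrictlyMoreExpressive (DEN maxAgg) (DHN maxAgg) ∧
      (DEN maxAgg graphSchema).Expresses LocallyTransitive ∧
      ¬ (DHN maxAgg graphSchema).Expresses LocallyTransitive) := by
  have h₁ : SameExpressivePower EML (DEN maxAgg) :=
    ⟨eml_atLeastAsExpressive_den_maxAgg, den_atLeastAsExpressive_eml regularAggregation_maxAgg⟩
  have h₂ : AtLeastAsExpressive (DEN sumAgg) UQAFO := fun S P h =>
    den_atLeastAsExpressive_eml regularAggregation_sumAgg S P
      (sameExpressivePower_uqafo_eml.2 S P h)
  have h₃ : ¬ (UQAFO pqrSchema).Expresses PQROrder := fun h =>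
    not_eml_expresses_pqrOrder (sameExpressivePower_uqafo_eml.2 _ _ h)
  have h₄ : (DEN maxAgg graphSchema).Expresses LocallyTransitive :=
    h₁.2 _ _ eml_expresses_locallyTransitive
  refine ⟨⟨sameExpressivePower_uqafo_eml, h₁, ?_, ?_⟩, ⟨⟨h₂, ?_⟩, den_sumAgg_expresses_pqrOrder, h₃⟩,
    sameExpressivePower_den_dhn_sumAgg, ⟨?_, ?_⟩, h₄,
    not_dhn_maxAgg_expresses_locallyTransitive⟩
  · exact fun S P h => sameExpressivePower_uqafo_eml.1 S P (h₁.1 S P h)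
  · exact fun S P h => h₁.2 S P (sameExpressivePower_uqafo_eml.2 S P h)
  · exact fun h => h₃ (h _ _ den_sumAgg_expresses_pqrOrder)
  · exact fun S P h => h₁.2 S P (eml_atLeastAsExpressive_dhn_maxAgg S P h)
  · exact fun h => not_dhn_maxAgg_expresses_locallyTransitive (h _ _ h₄)
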